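/- \textbf{Weak simultaneous measurement with system evolution.} Let $\Omega$ be a finite set of pointers. Pointer $j\in\Omega$ has a complex Hilbert space $\mathcal H_j$, a unit vector $\phi_j\in\mathcal H_j$ and bounded self-adjoint operators $r_j,s_j$ on $\mathcal H_j$; write $\langle T\rangle_{\phi_j}=\langle\phi_j|T|\phi_j\rangle$. The system has a complex Hilbert space $\mathcal S$, unit vectors $\psi_i,\psi_f\in\mathcal S$, a bounded self-adjoint Hamiltonian $H_{\mathcal S}$ and bounded self-adjoint operators $A_j$ $(j\in\Omega)$. Let $\tau>0$ and assume $\langle\psi_f|e^{-i\tau H_{\mathcal S}}|\psi_i\rangle\neq0$. On $\mathcal P\otimes\mathcal S$, where $\mathcal P=\bigotimes_{j\in\Omega}\mathcal H_j$, put for $\gamma\in\mathbb R^\Omega$ $$H=\hat 1_{\mathcal P}\otimes H_{\mathcal S}+\sum_{k\in\Omega}\gamma_k\,\frac{s_k}{\tau}\otimes A_k,\qquad P_i=\Big(\bigotimes_{j}|\phi_j\rangle\langle\phi_j|\Big)\otimes|\psi_i\rangle\langle\psi_i|,\qquad P_f=\hat 1_{\mathcal P}\otimes|\psi_f\rangle\langle\psi_f|,$$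 and let $$\sigma=\sigma(\gamma)=\frac{\operatorname{tr}_{\mathcal S}\big(P_fe^{-i\tau H}P_ie^{i\tau H}\big)}{\operatorname{tr}\big(P_fe^{-i\tau H}P_ie^{i\tau H}\big)}$$ be the state of the pointers after postselection of the system in $\psi_f$. For $a\subseteq\Omega$ let $\langle\prod_{j\in a}r_j\rangle_\sigma=\operatorname{tr}\big((\prod_{j\in a}r_j)\,\sigma\big)$. For a function $f$ from the subsets of $\Omega$ to $\mathbb C$ with $f(\emptyset)\neq0$ let $\log^*f(\emptyset)=\log f(\emptyset)$ and, for $a\ne\emptyset$, $$\log^*f(a)=\sum_{p}(-1)^{|p|-1}(|p|-1)!\,\frac{\prod_{c\in p}f(c)}{f(\emptyset)^{|p|}},$$ the sum being over all partitions $p$ of $a$. For $a=\{a_1,\dots,a_k\}$ let $$\mathcal D(a)=\frac1{\tau^k}\sum_{\pi}\int_{\tau_1,\dots,\tau_{k+1}\ge0}\frac{\langle\psi_f|e^{-iH_{\mathcal S}\tau_{k+1}}A_{a_{\pi(k)}}e^{-iH_{\mathcal S}\tau_k}\cdots A_{a_{\pi(1)}}e^{-iH_{\mathcal S}\tau_1}|\psi_i\rangle}{\langle\psi_f|e^{-i\tau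 H_{\mathcal S}}|\psi_i\rangle}\,\delta\Big(\tau-\sum_{j=1}^{k+1}\tau_j\Big)\,d\tau_1\cdots d\tau_{k+1},$$ where $\pi$ runs over all permutations of $\{1,\dots,k\}$, and let $$\xi=\xi(a)=2(-i)^{|a|}\prod_{j\in a}\big(\langle r_js_j\rangle_{\phi_j}-\langle r_j\rangle_{\phi_j}\langle s_j\rangle_{\phi_j}\big).$$ Then for every $a\subseteq\Omega$ the pointer cumulant $\gamma\mapsto\log^*\langle\prod_{j\in a}r_j\rangle_{\sigma(\gamma)}$ is real analytic near $\gamma=0$, and to the lowest joint order in $\gamma$ it equals $(\prod_{j\in a}\gamma_j)\operatorname{Re}\{\xi\log^*\mathcal D(a)\}$ (up to the constant $\langle r_j\rangle_{\phi_j}$ if $a=\{j\}$): as $\gamma\to0$, $$\log^*\Big\langle\prod_{j\in a}r_j\Big\rangle_\sigma=\Big(\prod_{j\in a}\gamma_j\Big)\operatorname{Re}\{\xi\log^*\mathcal D(a)\}+O\big(\|\gamma\|^{|a|+1}\big)\qquad\text{if }|a|\neq1,$$ $$\langle r_j\rangle_\sigma=\langle r_j\rangle_{\phi_j}+\gamma_j\operatorname{Re}\{\xi\log^*\mathcal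 D(\{j\})\}+O\big(\|\gamma\|^{2}\big)\qquad\text{if }a=\{j\}.$$ -/

import Mathlib

noncomputable section

namespace WeakMeasurement

open scoped TensorProduct InnerProductSpace ComplexOrder
open UniformSpace

universe u v w

/-! ### The Hilbert space tensor product of a finite family of Hilbert spaces

`PreTensor H` is the algebraic tensor product of the `H j` with the pre-inner product determined by
`⟪⊗ x j, ⊗ y j⟫ = ∏ j, ⟪x j, y j⟫`; its completion is the Hilbert space tensor product. -/

section PiTensor

set_option linter.unusedSectionVars false

variable {Ω : Type u} [Fintype Ω] (H : Ω → Type v) [∀ j, NormedAddCommGroup (H j)]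
  [∀ j, InnerProductSpace ℂ (H j)]

/-- The algebraic tensor product of the spaces `H j` (a copy of Mathlib's type, because the latter
carries the projective seminorm and not the Hilbert space one). -/
def PreTensor : Type (max u v) := PiTensorProduct ℂ H

instance : AddCommGroup (PreTensor H) := inferInstanceAs (AddCommGroup (PiTensorProduct ℂ H))

instance : Module ℂ (PreTensor H) := inferInstanceAs (Module ℂ (PiTensorProduct ℂ H))

variable {H}

/-- The elementary tensor `⊗ x j`. -/
def PreTensor.tprod (x : ∀ j, H j) : PreTensor H := PiTensorProduct.tprod ℂ x

theorem PreTensor.exists_rep (z : PreTensor H) :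
    ∃ c : (∀ j, H j) →₀ ℂ, z = ∑ x ∈ c.support, c x • PreTensor.tprod x := by
  have hz : ∀ z : PiTensorProduct ℂ H,
      z ∈ Submodule.span ℂ (Set.range (PiTensorProduct.tprod ℂ (s := H))) := by
    rw [PiTensorProduct.span_tprod_eq_top]; exact fun _ => Submodule.mem_top
  obtain ⟨c, hc⟩ := (Finsupp.mem_span_range_iff_exists_finsupp).1 (hz z)
  exact ⟨c, hc.symm⟩

/-- The linear functional `⊗ y j ↦ ∏ j, ⟪x j, y j⟫`. -/
def PreTensor.bra (x : ∀ j, H j) : PreTensor H →ₗ[ℂ] ℂ :=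
  PiTensorProduct.lift ((MultilinearMap.mkPiAlgebra ℂ Ω ℂ).compLinearMap
    fun j => (innerSL ℂ (x j)).toLinearMap)

theorem PreTensor.bra_tprod (x y : ∀ j, H j) :
    PreTensor.bra x (PreTensor.tprod y) = ∏ j, ⟪x j, y j⟫_ℂ := by
  simp only [PreTensor.bra, PreTensor.tprod]
  erw [PiTensorProduct.lift.tprod]
  simp

theorem PreTensor.lin_ext {φ ψ : PreTensor H →ₗ[ℂ] ℂ}
    (h : ∀ y : ∀ j, H j, φ (PreTensor.tprod y) = ψ (PreTensor.tprod y)) : φ = ψ := by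
  refine LinearMap.ext fun z => ?_
  obtain ⟨c, rfl⟩ := PreTensor.exists_rep z
  simp [map_sum, h]

theorem PreTensor.bra_update_add [DecidableEq Ω] (x : ∀ j, H j) (i : Ω) (m m' : H i) :
    PreTensor.bra (Function.update x i (m + m')) =
      PreTensor.bra (Function.update x i m) + PreTensor.bra (Function.update x i m') := by
  refine PreTensor.lin_ext fun y => ?_
  have key : ∀ n : H i, ∏ j, ⟪Function.update x i n j, y j⟫_ℂ =
      ⟪n, y i⟫_ℂ * ∏ j ∈ Finset.univ.erase i, ⟪x j, y j⟫_ℂ := by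
    intro n
    rw [← Finset.mul_prod_erase _ _ (Finset.mem_univ i), Function.update_self]
    congr 1
    refine Finset.prod_congr rfl fun j hj => ?_
    rw [Function.update_of_ne (Finset.ne_of_mem_erase hj)]
  simp only [LinearMap.add_apply, PreTensor.bra_tprod, key, inner_add_left, add_mul]

theorem PreTensor.bra_update_smul [DecidableEq Ω] (x : ∀ j, H j) (i : Ω) (c : ℂ) (m : H i) :
    PreTensor.bra (Function.update x i (c • m)) =
      (starRingEnd ℂ c) • PreTensor.bra (Function.update x i m) := by
  refine PreTensor.lin_ext fun y => ?_
  have key : ∀ n : H i, ∏ j, ⟪Function.update x i n j, y j⟫_ℂ =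
      ⟪n, y i⟫_ℂ * ∏ j ∈ Finset.univ.erase i, ⟪x j, y j⟫_ℂ := by
    intro n
    rw [← Finset.mul_prod_erase _ _ (Finset.mem_univ i), Function.update_self]
    congr 1
    refine Finset.prod_congr rfl fun j hj => ?_
    rw [Function.update_of_ne (Finset.ne_of_mem_erase hj)]
  simp only [LinearMap.smul_apply, PreTensor.bra_tprod, key, inner_smul_left, smul_eq_mul,
    mul_assoc]

/-- The form `(y, x) ↦ ⟪x, y⟫`, linear in `y` and conjugate linear in `x`. -/
def PreTensor.form : PreTensor H →ₗ[ℂ] (PreTensor H →ₛₗ[starRingEnd ℂ] ℂ) :=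
  PiTensorProduct.lift
    { toFun := fun y =>
        { toFun := fun x => starRingEnd ℂ (PreTensor.bra y x)
          map_add' := fun x x' => by simp
          map_smul' := fun c x => by simp }
      map_update_add' := fun y i m m' => by
        refine LinearMap.ext fun x => ?_
        simp [PreTensor.bra_update_add]
      map_update_smul' := fun y i c m => by
        refine LinearMap.ext fun x => ?_
        simp [PreTensor.bra_update_smul] }

theorem PreTensor.form_tprod (y : ∀ j, H j) (x : PreTensor H) :
    PreTensor.form (PreTensor.tprod y) x = starRingEnd ℂ (PreTensor.bra y x) := by
  simp only [PreTensor.form, PreTensor.tprod]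
  erw [PiTensorProduct.lift.tprod]
  rfl

theorem PreTensor.form_tprod_tprod (x y : ∀ j, H j) :
    PreTensor.form (PreTensor.tprod y) (PreTensor.tprod x) = ∏ j, ⟪x j, y j⟫_ℂ := by
  rw [PreTensor.form_tprod, PreTensor.bra_tprod, map_prod]
  simp

theorem PreTensor.form_sum_sum (c d : (∀ j, H j) →₀ ℂ) (f g : (∀ j, H j) → (∀ j, H j)) :
    PreTensor.form (∑ y ∈ d.support, d y • PreTensor.tprod (g y))
        (∑ x ∈ c.support, c x • PreTensor.tprod (f x)) =
      ∑ x ∈ c.support, ∑ y ∈ d.support,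
        starRingEnd ℂ (c x) * (∏ j, ⟪f x j, g y j⟫_ℂ) * d y := by
  simp only [map_sum, map_smul, LinearMap.sum_apply, LinearMap.smul_apply, LinearMap.map_smulₛₗ,
    PreTensor.form_tprod_tprod, smul_eq_mul]
  refine Finset.sum_congr rfl fun x _ => ?_
  rw [Finset.mul_sum]
  refine Finset.sum_congr rfl fun y _ => ?_
  ring

theorem posSemidef_gram_family {n E : Type*} [NormedAddCommGroup E] [InnerProductSpace ℂ E]
    (f : n → E) : (Matrix.gram ℂ f).PosSemidef := by
  refine ⟨Matrix.isHermitian_gram ℂ f, fun c => ?_⟩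
  have h : (c.sum fun i xi => c.sum fun j xj => star xi * Matrix.gram ℂ f i j * xj) =
      ⟪∑ i ∈ c.support, c i • f i, ∑ i ∈ c.support, c i • f i⟫_ℂ := by
    simp only [Finsupp.sum, Matrix.gram_apply, sum_inner]
    refine Finset.sum_congr rfl fun x _ => ?_
    rw [inner_sum]
    refine Finset.sum_congr rfl fun y _ => ?_
    rw [inner_smul_left, inner_smul_right, RCLike.star_def]
    ring
  rw [h]
  exact RCLike.nonneg_iff.2 ⟨inner_self_nonneg, inner_self_im _⟩

/-- Monotonicity of entrywise products of positive semidefinite matrices. -/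
theorem posSemidef_prod_sub_prod {n ι : Type*} (s : Finset ι) (A B : ι → Matrix n n ℂ)
    (hB : ∀ j, (B j).PosSemidef) (hAB : ∀ j, (A j - B j).PosSemidef) :
    (Matrix.of fun x y => ∏ j ∈ s, B j x y).PosSemidef ∧
    ((Matrix.of fun x y => ∏ j ∈ s, A j x y) -
      Matrix.of fun x y => ∏ j ∈ s, B j x y).PosSemidef := by
  classical
  induction s using Finset.induction_on with
  | empty =>
    refine ⟨?_, ?_⟩
    · have h : (Matrix.of fun _ _ => ∏ j ∈ (∅ : Finset ι), (1 : ℂ) : Matrix n n ℂ) =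
          Matrix.gram ℂ (fun _ : n => (1 : ℂ)) := by
        ext; simp [Matrix.gram_apply]
      simpa using h ▸ posSemidef_gram_family (fun _ : n => (1 : ℂ))
    · simpa using (Matrix.PosSemidef.zero : (0 : Matrix n n ℂ).PosSemidef)
  | insert i s hi ih =>
    obtain ⟨h1, h2⟩ := ih
    have hA : (A i).PosSemidef := by simpa using (hAB i).add (hB i)
    have e1 : (Matrix.of fun x y => ∏ j ∈ insert i s, B j x y) =
        Matrix.hadamard (B i) (Matrix.of fun x y => ∏ j ∈ s, B j x y) := by
      ext x y; simp [Finset.prod_insert hi]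
    have e2 : ((Matrix.of fun x y => ∏ j ∈ insert i s, A j x y) -
        Matrix.of fun x y => ∏ j ∈ insert i s, B j x y) =
        Matrix.hadamard (A i) ((Matrix.of fun x y => ∏ j ∈ s, A j x y) -
          Matrix.of fun x y => ∏ j ∈ s, B j x y) +
        Matrix.hadamard (A i - B i) (Matrix.of fun x y => ∏ j ∈ s, B j x y) := by
      ext x y; simp [Finset.prod_insert hi]; ring
    exact ⟨e1 ▸ (hB i).hadamard h1, e2 ▸ (hA.hadamard h2).add ((hAB i).hadamard h1)⟩

theorem PreTensor.form_symm (x y : PreTensor H) :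
    starRingEnd ℂ (PreTensor.form x y) = PreTensor.form y x := by
  obtain ⟨c, rfl⟩ := PreTensor.exists_rep x
  obtain ⟨d, rfl⟩ := PreTensor.exists_rep y
  have h1 := PreTensor.form_sum_sum d c id id
  have h2 := PreTensor.form_sum_sum c d id id
  simp only [id] at h1 h2
  rw [h1, h2, Finset.sum_comm]
  simp only [map_sum, map_mul, map_prod, inner_conj_symm, Complex.conj_conj]
  refine Finset.sum_congr rfl fun x _ => Finset.sum_congr rfl fun y _ => ?_
  ring

theorem PreTensor.form_self_nonneg (x : PreTensor H) : 0 ≤ PreTensor.form x x := by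
  obtain ⟨c, rfl⟩ := PreTensor.exists_rep x
  have h0 := PreTensor.form_sum_sum c c id id
  simp only [id] at h0
  rw [h0]
  have h := (posSemidef_prod_sub_prod (n := ∀ j, H j) Finset.univ
    (fun j => Matrix.gram ℂ fun x : ∀ j, H j => x j)
    (fun j => Matrix.gram ℂ fun x : ∀ j, H j => x j) (fun j => posSemidef_gram_family _)
    (fun j => by simpa using Matrix.PosSemidef.zero)).1.2 c
  simpa [Finsupp.sum, Matrix.gram_apply] using h

/-- The pre-inner product on the algebraic tensor product. -/
@[reducible] def PreTensor.core : PreInnerProductSpace.Core ℂ (PreTensor H) where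
  inner x y := PreTensor.form y x
  conj_inner_symm x y := PreTensor.form_symm x y
  re_inner_nonneg x := (Complex.nonneg_iff.1 (PreTensor.form_self_nonneg x)).1
  add_left x y z := by simp
  smul_left x y c := by simp

instance : SeminormedAddCommGroup (PreTensor H) :=
  @InnerProductSpace.Core.toSeminormedAddCommGroup ℂ (PreTensor H) _ _ _ PreTensor.core

instance : InnerProductSpace ℂ (PreTensor H) := InnerProductSpace.ofCore PreTensor.core

theorem PreTensor.inner_eq (x y : PreTensor H) : ⟪x, y⟫_ℂ = PreTensor.form y x := rfl

theorem PreTensor.inner_tprod (x y : ∀ j, H j) :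
    ⟪PreTensor.tprod x, PreTensor.tprod y⟫_ℂ = ∏ j, ⟪x j, y j⟫_ℂ :=
  PreTensor.form_tprod_tprod x y

/-- The linear map `⊗ T j` on the algebraic tensor product. -/
def PreTensor.mapLin (T : ∀ j, H j →L[ℂ] H j) : PreTensor H →ₗ[ℂ] PreTensor H :=
  PiTensorProduct.map (fun j => (T j).toLinearMap)

theorem PreTensor.mapLin_tprod (T : ∀ j, H j →L[ℂ] H j) (x : ∀ j, H j) :
    PreTensor.mapLin T (PreTensor.tprod x) = PreTensor.tprod (fun j => T j (x j)) :=
  PiTensorProduct.map_tprod _ _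

theorem PreTensor.norm_mapLin_le (T : ∀ j, H j →L[ℂ] H j) (x : PreTensor H) :
    ‖PreTensor.mapLin T x‖ ≤ (∏ j, ‖T j‖) * ‖x‖ := by
  refine le_of_sq_le_sq ?_ (by positivity)
  rw [mul_pow, @norm_sq_eq_re_inner ℂ, @norm_sq_eq_re_inner ℂ]
  obtain ⟨c, rfl⟩ := PreTensor.exists_rep x
  have h0 := PreTensor.form_sum_sum c c id id
  simp only [id] at h0
  have h1 : PreTensor.mapLin T (∑ x ∈ c.support, c x • PreTensor.tprod x) =
      ∑ x ∈ c.support, c x • PreTensor.tprod (fun j => T j (x j)) := by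
    simp only [map_sum, map_smul, PreTensor.mapLin_tprod]
  rw [h1, PreTensor.inner_eq, PreTensor.inner_eq, h0,
    PreTensor.form_sum_sum c c (fun x j => T j (x j)) (fun x j => T j (x j))]
  have h := (posSemidef_prod_sub_prod (n := ∀ j, H j) Finset.univ
    (fun j => ‖T j‖ ^ 2 • Matrix.gram ℂ fun x : ∀ j, H j => x j)
    (fun j => Matrix.gram ℂ (T j ∘ fun x : ∀ j, H j => x j)) (fun j => posSemidef_gram_family _)
    (fun j => Matrix.posSemidef_opNorm_smul_gram_sub_gram _ _)).2.2 c
  have h' := (Complex.nonneg_iff.1 h).1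
  have e : (c.sum fun x a => c.sum fun y b => star a * (((Matrix.of fun x y => ∏ j,
      (‖T j‖ ^ 2 • Matrix.gram ℂ fun x : ∀ j, H j => x j) x y) - Matrix.of fun x y => ∏ j,
      (Matrix.gram ℂ (T j ∘ fun x : ∀ j, H j => x j)) x y : Matrix _ _ ℂ) x y) * b) =
      (((∏ j, ‖T j‖) ^ 2 : ℝ) : ℂ) * (∑ x ∈ c.support, ∑ y ∈ c.support,
        starRingEnd ℂ (c x) * (∏ j, ⟪x j, y j⟫_ℂ) * c y) -
      ∑ x ∈ c.support, ∑ y ∈ c.support,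
        starRingEnd ℂ (c x) * (∏ j, ⟪T j (x j), T j (y j)⟫_ℂ) * c y := by
    simp only [Finsupp.sum, Finset.mul_sum, ← Finset.sum_sub_distrib]
    refine Finset.sum_congr rfl fun x _ => Finset.sum_congr rfl fun y _ => ?_
    simp [Matrix.gram_apply, Finset.prod_mul_distrib, Finset.prod_pow]
    ring
  rw [e, Complex.sub_re, Complex.re_ofReal_mul] at h'
  simpa using h'

/-- The operator `⊗ T j` on the algebraic tensor product. -/
def PreTensor.mapL (T : ∀ j, H j →L[ℂ] H j) : PreTensor H →L[ℂ] PreTensor H :=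
  (PreTensor.mapLin T).mkContinuous (∏ j, ‖T j‖) (PreTensor.norm_mapLin_le T)

variable (H) in
/-- The Hilbert space tensor product `⨂ j, H j`. -/
def HilbertTensor : Type (max u v) := Completion (PreTensor H)

instance : NormedAddCommGroup (HilbertTensor H) :=
  inferInstanceAs (NormedAddCommGroup (Completion (PreTensor H)))

instance : InnerProductSpace ℂ (HilbertTensor H) :=
  inferInstanceAs (InnerProductSpace ℂ (Completion (PreTensor H)))

instance : CompleteSpace (HilbertTensor H) :=
  inferInstanceAs (CompleteSpace (Completion (PreTensor H)))

/-- The product vector `⊗ x j`. -/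
def productVector (x : ∀ j, H j) : HilbertTensor H :=
  ((PreTensor.tprod x : PreTensor H) : Completion (PreTensor H))

/-- The bounded operator `⊗ T j`. -/
def tensorOp (T : ∀ j, H j →L[ℂ] H j) : HilbertTensor H →L[ℂ] HilbertTensor H :=
  (PreTensor.mapL T).completion

/-- The operator on `⨂ j, H j` that acts as `T` on factor `k` and as the identity elsewhere. -/
def siteOp [DecidableEq Ω] (k : Ω) (T : H k →L[ℂ] H k) : HilbertTensor H →L[ℂ] HilbertTensor H :=
  tensorOp (Function.update (fun j => (1 : H j →L[ℂ] H j)) k T)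

theorem inner_productVector (x y : ∀ j, H j) :
    ⟪productVector x, productVector y⟫_ℂ = ∏ j, ⟪x j, y j⟫_ℂ :=
  (Completion.inner_coe _ _).trans (PreTensor.inner_tprod x y)

theorem tensorOp_productVector (T : ∀ j, H j →L[ℂ] H j) (x : ∀ j, H j) :
    tensorOp T (productVector x) = productVector (fun j => T j (x j)) := by
  refine (ContinuousLinearMap.completion_apply_coe (PreTensor.mapL T) _).trans ?_
  exact congrArg _ (PreTensor.mapLin_tprod T x)

end PiTensor

/-! ### Two factors, traces and partial traces -/

section Bipartite

variable (P : Type v) (S : Type w) [NormedAddCommGroup P] [InnerProductSpace ℂ P]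
  [NormedAddCommGroup S] [InnerProductSpace ℂ S]

/-- The Hilbert space tensor product `P ⊗ S` of two spaces. -/
def Bipartite : Type (max v w) := Completion (P ⊗[ℂ] S)

instance : NormedAddCommGroup (Bipartite P S) :=
  inferInstanceAs (NormedAddCommGroup (Completion (P ⊗[ℂ] S)))

instance : InnerProductSpace ℂ (Bipartite P S) :=
  inferInstanceAs (InnerProductSpace ℂ (Completion (P ⊗[ℂ] S)))

instance : CompleteSpace (Bipartite P S) :=
  inferInstanceAs (CompleteSpace (Completion (P ⊗[ℂ] S)))

variable {P S}

/-- The bounded operator `B ⊗ A` on `P ⊗ S`. -/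
def opTensor (B : P →L[ℂ] P) (A : S →L[ℂ] S) : Bipartite P S →L[ℂ] Bipartite P S :=
  (TensorProduct.mapL B A).completion

/-- The bounded operator `x ↦ x ⊗ e` from `P` to `P ⊗ S`. -/
def tensorRight (e : S) : P →L[ℂ] Bipartite P S :=
  Completion.toComplL ∘L (TensorProduct.mkL ℂ P S).flip e

/-- The operator `|x⟩⟨x|`, the orthogonal projector onto the line of `x` when `‖x‖ = 1`. -/
def ketbra (x : S) : S →L[ℂ] S := InnerProductSpace.rankOne ℂ x x

variable (S) in
/-- The index set of a chosen Hilbert basis of `S`. -/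
def basisSet [CompleteSpace S] : Set S := (exists_hilbertBasis ℂ S).choose

variable (S) in
/-- A chosen Hilbert basis of `S`. -/
def chosenBasis [CompleteSpace S] : HilbertBasis (basisSet S) ℂ S :=
  (exists_hilbertBasis ℂ S).choose_spec.choose

/-- The trace `∑ i, ⟨e i| T |e i⟩` over an orthonormal basis; on trace class operators it does not
depend on the basis. -/
def trace [CompleteSpace S] (T : S →L[ℂ] S) : ℂ :=
  ∑' i, ⟪chosenBasis S i, T (chosenBasis S i)⟫_ℂ

/-- The partial trace over `S`: `∑ i, (1 ⊗ ⟨e i|) T (1 ⊗ |e i⟩)` over an orthonormal basis of `S`; the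
series converges in norm when `T` is of trace class. -/
def partialTrace [CompleteSpace P] [CompleteSpace S] (T : Bipartite P S →L[ℂ] Bipartite P S) :
    P →L[ℂ] P :=
  ∑' i, ContinuousLinearMap.adjoint (tensorRight (P := P) (chosenBasis S i)) ∘L T ∘L
    tensorRight (chosenBasis S i)

end Bipartite

/-! ### Cumulants -/

/-- The cumulant `log* f` of a function `f` on finite subsets: `log (f ∅)` at `∅`, and
`∑ p, (-1)^(|p|-1) (|p|-1)! ∏ c ∈ p, f c / (f ∅)^|p|`, summed over all partitions `p` of `a`, at
`a ≠ ∅`. -/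
def logStar {Ω : Type u} [DecidableEq Ω] (f : Finset Ω → ℂ) (a : Finset Ω) : ℂ :=
  if a = ∅ then Complex.log (f ∅)
  else ∑ p : Finpartition a,
    (-1) ^ (p.parts.card - 1) * ((p.parts.card - 1).factorial : ℂ) *
      ((∏ c ∈ p.parts, f c) / f ∅ ^ p.parts.card)

/-! ### The measurement -/

/-- The data of a simultaneous measurement of the system `S` by pointers `j : Ω` with state spaces
`H j`. -/
structure Setup (Ω : Type u) (H : Ω → Type v) (S : Type w) [∀ j, NormedAddCommGroup (H j)]
    [∀ j, InnerProductSpace ℂ (H j)] [NormedAddCommGroup S] [InnerProductSpace ℂ S] where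
  /-- the duration of the coupling -/
  τ : ℝ
  /-- the Hamiltonian of the system -/
  HS : S →L[ℂ] S
  /-- the system operator to which pointer `j` is coupled -/
  A : Ω → S →L[ℂ] S
  /-- the operator of pointer `j` through which it is coupled -/
  s : ∀ j, H j →L[ℂ] H j
  /-- the observable measured on pointer `j` -/
  r : ∀ j, H j →L[ℂ] H j
  /-- the initial state of pointer `j` -/
  φ : ∀ j, H j
  /-- the initial state of the system -/
  ψi : S
  /-- the postselected final state of the system -/
  ψf : S

namespace Setup

variable {Ω : Type u} {H : Ω → Type v} {S : Type w} [∀ j, NormedAddCommGroup (H j)]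
  [∀ j, InnerProductSpace ℂ (H j)] [NormedAddCommGroup S] [InnerProductSpace ℂ S]
  (W : Setup Ω H S)

/-- The evolution `exp (-i t HS)` of the system alone. -/
def sysEvol (t : ℝ) : S →L[ℂ] S := NormedSpace.exp ((-Complex.I * (t : ℂ)) • W.HS)

section Pointers

variable [Fintype Ω] [DecidableEq Ω]

/-- The total Hamiltonian `1 ⊗ HS + ∑ k, γ k (s k / τ) ⊗ A k`. -/
def hamiltonian (γ : Ω → ℝ) :
    Bipartite (HilbertTensor H) S →L[ℂ] Bipartite (HilbertTensor H) S :=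
  opTensor 1 W.HS + ∑ k, (γ k : ℂ) • opTensor ((W.τ : ℂ)⁻¹ • siteOp k (W.s k)) (W.A k)

/-- The projector onto the initial state. -/
def projInit : Bipartite (HilbertTensor H) S →L[ℂ] Bipartite (HilbertTensor H) S :=
  opTensor (tensorOp fun j => ketbra (W.φ j)) (ketbra W.ψi)

/-- The projector of the postselection. -/
def projFinal : Bipartite (HilbertTensor H) S →L[ℂ] Bipartite (HilbertTensor H) S :=
  opTensor 1 (ketbra W.ψf)

/-- The operator `P_f e^{-iτH} P_i e^{iτH}`. -/
def unnormalized (γ : Ω → ℝ) :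
    Bipartite (HilbertTensor H) S →L[ℂ] Bipartite (HilbertTensor H) S :=
  W.projFinal * NormedSpace.exp ((-Complex.I * (W.τ : ℂ)) • W.hamiltonian γ) * W.projInit *
    NormedSpace.exp ((Complex.I * (W.τ : ℂ)) • W.hamiltonian γ)

variable [CompleteSpace S]

/-- The state `σ` of the pointers after the postselection. -/
def pointerState (γ : Ω → ℝ) : HilbertTensor H →L[ℂ] HilbertTensor H :=
  (trace (W.unnormalized γ))⁻¹ • partialTrace (W.unnormalized γ)

/-- The moment `⟨∏ j ∈ a, r j⟩_σ`. -/
def pointerMoment (γ : Ω → ℝ) (a : Finset Ω) : ℂ :=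
  trace (tensorOp (fun j => if j ∈ a then W.r j else 1) * W.pointerState γ)

/-- The pointer cumulant `log* ⟨∏ j ∈ a, r j⟩_σ`, as a function of the coupling strengths. -/
def pointerCumulant (a : Finset Ω) (γ : Ω → ℝ) : ℂ := logStar (W.pointerMoment γ) a

end Pointers

/-- `e^{-i HS t_{k+1}} B_k e^{-i HS t_k} ⋯ B_1 e^{-i HS t_1}`, with indices starting at `0`. -/
def sequentialOp : (k : ℕ) → (Fin k → S →L[ℂ] S) → (Fin (k + 1) → ℝ) → S →L[ℂ] S
  | 0, _, t => W.sysEvol (t 0)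
  | k + 1, B, t => W.sysEvol (t (Fin.last (k + 1))) * B (Fin.last k) *
      sequentialOp k (fun i => B i.castSucc) (fun i => t i.castSucc)

/-- The sequential weak value `(B_k, …, B_1)_w[t_{k+1}, …, t_1]`. -/
def seqWeakValue (k : ℕ) (B : Fin k → S →L[ℂ] S) (t : Fin (k + 1) → ℝ) : ℂ :=
  ⟪W.ψf, W.sequentialOp k B t W.ψi⟫_ℂ / ⟪W.ψf, W.sysEvol W.τ W.ψi⟫_ℂ

/-- The average of the sequential weak values over all orderings of the `A j`, `j ∈ a`, and all
splittings `τ = t_1 + ⋯ + t_{k+1}` into intervals of lengths `t_i ≥ 0`; the constraint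
`δ(τ - ∑ t_i)` is used to eliminate the last length. -/
def avgWeakValue [DecidableEq Ω] (a : Finset Ω) : ℂ :=
  ((W.τ : ℂ) ^ a.card)⁻¹ * ∑ e : Fin a.card ≃ a,
    ∫ t in {t : Fin a.card → ℝ | (∀ i, 0 ≤ t i) ∧ ∑ i, t i ≤ W.τ},
      W.seqWeakValue a.card (fun i => W.A (e i)) (Fin.snoc (α := fun _ => ℝ) t (W.τ - ∑ i, t i))

/-- The expectation `⟨φ j| T |φ j⟩`. -/
def pointerMean (j : Ω) (T : H j →L[ℂ] H j) : ℂ := ⟪W.φ j, T (W.φ j)⟫_ℂ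

/-- The constant `ξ = 2 (-i)^|a| ∏ j ∈ a, (⟨r j s j⟩ - ⟨r j⟩ ⟨s j⟩)`. -/
def xi (a : Finset Ω) : ℂ :=
  2 * (-Complex.I) ^ a.card *
    ∏ j ∈ a, (W.pointerMean j (W.r j * W.s j) - W.pointerMean j (W.r j) * W.pointerMean j (W.s j))

end Setup

end WeakMeasurement

end

noncomputable section

namespace WeakMeasurement

open scoped TensorProduct InnerProductSpace ComplexOrder
open UniformSpace

universe u v w

/-! ### The algebra of cumulants -/

section Cumulants

variable {Ω : Type u} [DecidableEq Ω]

/-! The operator `P_f e^{-iτH} P_i e^{iτH}` has rank one, and its partial trace is |χ⟩⟨χ| for the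
pointer vector χ(γ) = (1 ⊗ ⟨ψf|) e^{-iτH} (φ ⊗ ψi). Each pointer moment is therefore ⟨χ, ∏ r_j χ⟩ /
⟨χ, χ⟩ (`pointerMoment_eq`). The denominator is nonzero near γ = 0, which gives analyticity.

A set function f corresponds to the polynomial ∑ f(a) x^a in variables with x_j² = 0. There
`subsetConv` is the product and `logStar` the logarithm, so cumulants of products are sums
(`logStar_subsetConv`), and constant factors drop out on nonempty sets. Writing r_j = (r_j - ⟨r_j⟩)
+ ⟨r_j⟩ multiplies the moments of the centred observables by the factor ∏ ⟨r_j⟩, whose cumulants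
live on singletons; this is the origin of the exceptional case |a| = 1.

The Dyson series expands χ into words over Ω. A word contributes a monomial in γ, an excited pointer
vector ⊗ s_j^{n_j} φ_j and a time-ordered system amplitude. In ⟨χ, ∏_{j ∈ c} (r_j - ⟨r_j⟩) χ⟩ every
j ∈ c must occur in the bra word or the ket word, because ⟨φ_j, (r_j - ⟨r_j⟩) φ_j⟩ = 0. Up to order
|c| only pairs that use each letter of c exactly once survive: a set b on the ket, c \ b on the bra.
The sum over orderings of b gives 𝒟(b). So the coefficient of ∏ γ_j is the convolution of L(b) =
⟨ψf|e^{-iτH_S}|ψi⟩ ∏_{j ∈ b} (-i cov_j) 𝒟(b) with its conjugate (`rawMoment_centered_isBigO`).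

Finally the lowest order of a cumulant is the cumulant of the lowest orders (`isBigO_logStar_sub`),
and the cumulant of the convolution is log* L plus its conjugate, that is 2 Re log* L; the remaining
constants form ξ (`logStar_lowestOrder_conv`). -/

theorem finpartition_sigma_ext {x y : Σ b : Finset Ω, Finpartition b} (h : x.1 = y.1)
    (h' : x.2.parts = y.2.parts) : x = y := by
  obtain ⟨b, p⟩ := x
  obtain ⟨c, q⟩ := y
  obtain rfl : b = c := h
  exact congrArg _ (Finpartition.ext h')

/-- The partition of `a \ d` obtained from a partition of `a` by deleting its part `d`. -/
def deletePart {a : Finset Ω} (p : Finpartition a) {d : Finset Ω} (hd : d ∈ p.parts) :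
    Finpartition (a \ d) where
  parts := p.parts.erase d
  supIndep := p.supIndep.subset (Finset.erase_subset _ _)
  sup_parts := by
    ext x
    simp only [Finset.mem_sup, Finset.mem_erase, id, Finset.mem_sdiff]
    constructor
    · rintro ⟨c, ⟨hc, hcp⟩, hx⟩
      exact ⟨p.subset hcp hx, fun hxd => hc (p.eq_of_mem_parts hcp hd hx hxd)⟩
    · rintro ⟨hx, hxd⟩
      obtain ⟨c, hc, hxc⟩ := p.exists_mem hx
      exact ⟨c, ⟨fun h => hxd (h ▸ hxc), hc⟩, hxc⟩
  bot_notMem := fun h => p.bot_notMem (Finset.mem_of_mem_erase h)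

/-- Adding a part to a partition of a proper subset is the same as distinguishing a part. -/
theorem sum_finpartition_ssubset (a : Finset Ω) (j : Ω) (hj : j ∈ a)
    (F : Finset (Finset Ω) → ℂ) :
    ∑ b ∈ a.ssubsets with j ∈ b, ∑ p : Finpartition b, F (insert (a \ b) p.parts) =
      ∑ p : Finpartition a, ∑ _d ∈ p.parts with j ∉ _d, F p.parts := by
  rw [Finset.sum_sigma', Finset.sum_sigma']
  have hsub {x : Σ b : Finset Ω, Finpartition b}
      (hx : x ∈ (a.ssubsets.filter (j ∈ ·)).sigma fun _ => Finset.univ) : x.1 ⊂ a ∧ j ∈ x.1 := by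
    simpa using hx
  refine Finset.sum_bij'
    (fun x hx => ⟨x.2.extend (b := a \ x.1) (c := a)
      (by simpa [Finset.sdiff_eq_empty_iff_subset] using (hsub hx).1.2)
      Finset.disjoint_sdiff (Finset.union_sdiff_of_subset (hsub hx).1.1), a \ x.1⟩)
    (fun y hy => ⟨a \ y.2, deletePart y.1 (d := y.2) (by simp at hy; exact hy.1)⟩) ?_ ?_ ?_ ?_ ?_
  · intro x hx
    have := hsub hx
    simp [this.2]
  · rintro ⟨p, d⟩ hy
    simp only [Finset.mem_sigma, Finset.mem_univ, Finset.mem_filter, true_and] at hy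
    simp only [Finset.mem_sigma, Finset.mem_univ, Finset.mem_filter, and_true,
      Finset.mem_ssubsets, Finset.mem_sdiff]
    refine ⟨?_, hj, hy.2⟩
    refine Finset.sdiff_ssubset (p.subset hy.1) (p.nonempty_of_mem_parts hy.1)
  · intro x hx
    have h := hsub hx
    refine finpartition_sigma_ext ?_ ?_
    · simpa using h.1.1
    · simp only [deletePart, Finpartition.extend_parts]
      refine Finset.erase_insert fun hmem => ?_
      have h1 := x.2.subset hmem
      obtain ⟨i, hi, hi'⟩ := Finset.exists_of_ssubset h.1
      exact hi' (h1 (Finset.mem_sdiff.2 ⟨hi, hi'⟩))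
  · rintro ⟨p, d⟩ hy
    simp only [Finset.mem_sigma, Finset.mem_univ, Finset.mem_filter, true_and] at hy
    have hd : a \ (a \ d) = d := by
      simpa using p.subset hy.1
    refine Sigma.ext (Finpartition.ext ?_) (heq_of_eq hd)
    simp only [deletePart, Finpartition.extend_parts, hd]
    exact Finset.insert_erase hy.1
  · intro x hx
    simp

/-- The parts of a partition are disjoint, so only `p.part j` is excluded. -/
theorem card_parts_filter_notMem {a : Finset Ω} (p : Finpartition a) {j : Ω} (hj : j ∈ a) :
    (p.parts.filter (j ∉ ·)).card = p.parts.card - 1 := by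
  have h : p.parts.filter (j ∉ ·) = p.parts.erase (p.part j) := by
    ext c
    simp only [Finset.mem_filter, Finset.mem_erase]
    constructor
    · rintro ⟨hc, hjc⟩
      exact ⟨fun h => hjc (h ▸ p.mem_part_self.2 hj), hc⟩
    · rintro ⟨hc, hcp⟩
      exact ⟨hcp, fun hjc => hc (p.part_eq_of_mem hcp hjc).symm⟩
  rw [h, Finset.card_erase_of_mem (p.part_mem.2 hj)]

theorem logStar_of_ne_empty (f : Finset Ω → ℂ) {a : Finset Ω} (ha : a ≠ ∅) :
    logStar f a = ∑ p : Finpartition a,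
      (-1) ^ (p.parts.card - 1) * ((p.parts.card - 1).factorial : ℂ) *
        ((∏ c ∈ p.parts, f c) / f ∅ ^ p.parts.card) := if_neg ha

/-- The recursion that expresses `f` as the exponential of `log* f`. -/
theorem eq_sum_logStar_mul {f : Finset Ω → ℂ} (hf : f ∅ ≠ 0) {a : Finset Ω} {j : Ω}
    (hj : j ∈ a) : f a = ∑ b ∈ a.powerset with j ∈ b, logStar f b * f (a \ b) := by
  have ha : a ≠ ∅ := Finset.ne_empty_of_mem hj
  have hsplit : a.powerset.filter (j ∈ ·) = insert a (a.ssubsets.filter (j ∈ ·)) := by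
    ext b
    simp only [Finset.mem_filter, Finset.mem_powerset, Finset.mem_insert, Finset.mem_ssubsets]
    constructor
    · rintro ⟨hb, hjb⟩
      rcases hb.eq_or_ssubset with h | h
      · exact .inl h
      · exact .inr ⟨h, hjb⟩
    · rintro (rfl | ⟨h, hjb⟩)
      · exact ⟨subset_rfl, hj⟩
      · exact ⟨h.1, hjb⟩
  rw [hsplit, Finset.sum_insert (by simp)]
  -- The cumulant weight of p, written in terms of P = p ∪ {a \ b}: since |p| = |P| - 1, the sign
  -- and the factorial involve |P| - 2.
  let F : Finset (Finset Ω) → ℂ := fun P => (-1) ^ (P.card - 2) *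
    ((P.card - 2).factorial : ℂ) * ((∏ c ∈ P, f c) / f ∅ ^ (P.card - 1))
  have h1 : ∑ b ∈ a.ssubsets with j ∈ b, logStar f b * f (a \ b) =
      ∑ b ∈ a.ssubsets with j ∈ b, ∑ p : Finpartition b, F (insert (a \ b) p.parts) := by
    refine Finset.sum_congr rfl fun b hb => ?_
    simp only [Finset.mem_filter, Finset.mem_ssubsets] at hb
    rw [logStar_of_ne_empty f (Finset.ne_empty_of_mem hb.2), Finset.sum_mul]
    refine Finset.sum_congr rfl fun p _ => ?_
    have hmem : a \ b ∉ p.parts := fun hmem => by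
      obtain ⟨i, hi, hi'⟩ := Finset.exists_of_ssubset hb.1
      exact hi' (p.subset hmem (Finset.mem_sdiff.2 ⟨hi, hi'⟩))
    simp only [F, Finset.card_insert_of_notMem hmem, Finset.prod_insert hmem, Nat.add_sub_cancel]
    rw [show p.parts.card + 1 - 2 = p.parts.card - 1 by omega]
    ring
  rw [h1, sum_finpartition_ssubset a j hj, Finset.sdiff_self, logStar_of_ne_empty f ha,
    Finset.sum_mul, ← Finset.sum_add_distrib]
  have htop : (Finpartition.indiscrete ha).parts = {a} := rfl
  -- A partition with k + 2 parts cancels: its k + 1 parts without `j` each contribute (-1)^k k!,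
  -- against the coefficient (-1)^(k+1) (k+1)! from `logStar f a`. Only the partition with one part
  -- remains.
  rw [Finset.sum_eq_single (Finpartition.indiscrete ha)]
  · have hempty : ({a} : Finset (Finset Ω)).filter (j ∉ ·) = ∅ := by simp [hj]
    simp [F, hempty, hf]
  · intro p _ hp
    have hcard : 2 ≤ p.parts.card := by
      by_contra hlt
      have hpos := (p.parts_nonempty ha).card_pos
      obtain ⟨c, hc⟩ := Finset.card_eq_one.1 (by omega : p.parts.card = 1)
      refine hp (Finpartition.ext ?_)
      rw [htop, hc]
      have := p.sup_parts
      rw [hc] at this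
      simpa using this
    rw [Finset.sum_const, card_parts_filter_notMem p hj, nsmul_eq_mul]
    simp only [F]
    obtain ⟨k, hk⟩ := Nat.exists_eq_add_of_le' hcard
    rw [hk, show k + 2 - 1 = k + 1 from rfl, show k + 2 - 2 = k from rfl, Nat.factorial_succ]
    push_cast
    field_simp
    ring
  · simp

/-- The recursion determines the cumulants. -/
theorem logStar_eq_of_recursion {f κ : Finset Ω → ℂ} (hf : f ∅ ≠ 0)
    (h : ∀ a : Finset Ω, ∀ j ∈ a, f a = ∑ b ∈ a.powerset with j ∈ b, κ b * f (a \ b))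
    {a : Finset Ω} (ha : a.Nonempty) : logStar f a = κ a := by
  induction a using Finset.strongInduction with
  | H a ih =>
    obtain ⟨j, hj⟩ := ha
    have h1 := h a j hj
    rw [eq_sum_logStar_mul hf hj] at h1
    have hmem : a ∈ a.powerset.filter (j ∈ ·) := by simp [hj]
    rw [← Finset.add_sum_erase _ _ hmem, ← Finset.add_sum_erase _ _ hmem] at h1
    have h2 : ∑ b ∈ (a.powerset.filter (j ∈ ·)).erase a, logStar f b * f (a \ b) =
        ∑ b ∈ (a.powerset.filter (j ∈ ·)).erase a, κ b * f (a \ b) := by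
      refine Finset.sum_congr rfl fun b hb => ?_
      simp only [Finset.mem_erase, Finset.mem_filter, Finset.mem_powerset] at hb
      rw [ih b (hb.2.1.ssubset_of_ne hb.1) ⟨j, hb.2.2⟩]
    rw [h2, Finset.sdiff_self] at h1
    exact mul_right_cancel₀ hf (add_right_cancel h1)

/-- The product of functions of finite sets for which `∑ f a x^a` is multiplicative. -/
def subsetConv (f g : Finset Ω → ℂ) (a : Finset Ω) : ℂ := ∑ b ∈ a.powerset, f b * g (a \ b)

theorem subsetConv_empty (f g : Finset Ω → ℂ) : subsetConv f g ∅ = f ∅ * g ∅ := by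
  simp [subsetConv]

theorem subsetConv_comm (f g : Finset Ω → ℂ) : subsetConv f g = subsetConv g f := by
  ext a
  refine Finset.sum_bij' (fun b _ => a \ b) (fun b _ => a \ b) ?_ ?_ ?_ ?_ ?_
  · intro b hb; simp
  · intro b hb; simp
  · intro b hb; simpa using hb
  · intro b hb; simpa using hb
  · intro b hb
    rw [Finset.mem_powerset] at hb
    rw [Finset.sdiff_sdiff_eq_self hb, mul_comm]

/-- The recursion of `f` turns into a part of the recursion of a product. -/
theorem sum_subsetConv_of_mem {f κ : Finset Ω → ℂ} (g : Finset Ω → ℂ) {a : Finset Ω} {j : Ω}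
    (h : ∀ a : Finset Ω, j ∈ a → f a = ∑ b ∈ a.powerset with j ∈ b, κ b * f (a \ b)) :
    ∑ c ∈ a.powerset with j ∈ c, f c * g (a \ c) =
      ∑ b ∈ a.powerset with j ∈ b, κ b * subsetConv f g (a \ b) := by
  have h1 : ∑ c ∈ a.powerset with j ∈ c, f c * g (a \ c) = ∑ c ∈ a.powerset with j ∈ c,
      ∑ b ∈ c.powerset with j ∈ b, κ b * f (c \ b) * g (a \ c) := by
    refine Finset.sum_congr rfl fun c hc => ?_
    rw [h c (Finset.mem_filter.1 hc).2, Finset.sum_mul]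
  rw [h1]
  simp only [subsetConv, Finset.mul_sum]
  rw [Finset.sum_sigma', Finset.sum_sigma']
  -- Both sides sum over the splittings of `a` into b, c \ b and a \ c; only the order of choosing
  -- the blocks differs.
  refine Finset.sum_bij' (fun x _ => ⟨x.2, x.1 \ x.2⟩) (fun x _ => ⟨x.1 ∪ x.2, x.1⟩) ?_ ?_ ?_ ?_ ?_
  · rintro ⟨c, b⟩ hx
    simp only [Finset.mem_sigma, Finset.mem_filter, Finset.mem_powerset] at hx ⊢
    exact ⟨⟨hx.2.1.trans hx.1.1, hx.2.2⟩, Finset.sdiff_subset_sdiff hx.1.1 subset_rfl⟩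
  · rintro ⟨b, c⟩ hx
    simp only [Finset.mem_sigma, Finset.mem_filter, Finset.mem_powerset] at hx ⊢
    exact ⟨⟨Finset.union_subset hx.1.1 (hx.2.trans Finset.sdiff_subset),
      Finset.mem_union_left _ hx.1.2⟩, Finset.subset_union_left, hx.1.2⟩
  · rintro ⟨c, b⟩ hx
    simp only [Finset.mem_sigma, Finset.mem_filter, Finset.mem_powerset] at hx
    simp [Finset.union_sdiff_of_subset hx.2.1]
  · rintro ⟨b, c⟩ hx
    simp only [Finset.mem_sigma, Finset.mem_filter, Finset.mem_powerset] at hx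
    have hd : Disjoint c b := Finset.disjoint_of_subset_left hx.2 Finset.sdiff_disjoint
    simp [Finset.union_sdiff_left, Finset.sdiff_eq_self_of_disjoint hd]
  · rintro ⟨c, b⟩ hx
    simp only [Finset.mem_sigma, Finset.mem_filter, Finset.mem_powerset] at hx
    have hs : (a \ b) \ (c \ b) = a \ c := by
      ext i
      have := @hx.2.1 i
      simp only [Finset.mem_sdiff]
      tauto
    rw [hs, mul_assoc]

/-- Cumulants of a product are sums of cumulants. -/
theorem logStar_subsetConv {f g : Finset Ω → ℂ} (hf : f ∅ ≠ 0) (hg : g ∅ ≠ 0) {a : Finset Ω}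
    (ha : a.Nonempty) : logStar (subsetConv f g) a = logStar f a + logStar g a := by
  refine logStar_eq_of_recursion (κ := fun a => logStar f a + logStar g a)
    (by rw [subsetConv_empty]; exact mul_ne_zero hf hg) (fun a j hj => ?_) ha
  have hF := sum_subsetConv_of_mem (κ := logStar f) g (a := a) (j := j)
    fun a hj => eq_sum_logStar_mul hf hj
  have hG := sum_subsetConv_of_mem (κ := logStar g) f (a := a) (j := j)
    fun a hj => eq_sum_logStar_mul hg hj
  rw [subsetConv_comm g f] at hG
  simp only [add_mul, Finset.sum_add_distrib]
  -- The letter `j` lies either in the argument of `f` or in that of `g`, and each case is one of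
  -- the two partial recursions.
  rw [← hF, ← hG, subsetConv, ← Finset.sum_filter_add_sum_filter_not _ (j ∈ ·)]
  congr 1
  refine Finset.sum_bij' (fun b _ => a \ b) (fun b _ => a \ b) ?_ ?_ ?_ ?_ ?_
  · intro b hb
    simp only [Finset.mem_filter, Finset.mem_powerset] at hb ⊢
    exact ⟨Finset.sdiff_subset, Finset.mem_sdiff.2 ⟨hj, hb.2⟩⟩
  · intro b hb
    simp only [Finset.mem_filter, Finset.mem_powerset] at hb ⊢
    exact ⟨Finset.sdiff_subset, fun h => (Finset.mem_sdiff.1 h).2 hb.2⟩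
  · intro b hb
    simp only [Finset.mem_filter, Finset.mem_powerset] at hb
    exact Finset.sdiff_sdiff_eq_self hb.1
  · intro b hb
    simp only [Finset.mem_filter, Finset.mem_powerset] at hb
    exact Finset.sdiff_sdiff_eq_self hb.1
  · intro b hb
    simp only [Finset.mem_filter, Finset.mem_powerset] at hb
    rw [Finset.sdiff_sdiff_eq_self hb.1, mul_comm]

/-- The cumulants of independent variables. -/
theorem logStar_prod (r : Ω → ℂ) {a : Finset Ω} (ha : a.Nonempty) :
    logStar (fun c => ∏ j ∈ c, r j) a = if a.card = 1 then ∏ j ∈ a, r j else 0 := by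
  refine logStar_eq_of_recursion (κ := fun a => if a.card = 1 then ∏ j ∈ a, r j else 0)
    (by simp) (fun a j hj => ?_) ha
  -- The candidate cumulant vanishes off singletons, and {j} is the only singleton containing `j`.
  rw [Finset.sum_eq_single {j}]
  · simp [← Finset.mul_prod_erase a r hj, Finset.sdiff_singleton_eq_erase]
  · intro b hb hbj
    simp only [Finset.mem_filter, Finset.mem_powerset] at hb
    have : b.card ≠ 1 := fun h => by
      obtain ⟨i, rfl⟩ := Finset.card_eq_one.1 h
      exact hbj (by rw [Finset.mem_singleton.1 hb.2])
    simp [this]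
  · intro h
    simp [hj] at h

/-- Every term is homogeneous of degree zero in f: a partition has as many factors f(c) as powers of
f(∅) in the denominator. This removes the normalization of the state. -/
theorem logStar_const_mul (f : Finset Ω → ℂ) {z : ℂ} (hz : z ≠ 0) {a : Finset Ω}
    (ha : a.Nonempty) : logStar (fun c => z * f c) a = logStar f a := by
  rw [logStar_of_ne_empty _ ha.ne_empty, logStar_of_ne_empty _ ha.ne_empty]
  refine Finset.sum_congr rfl fun p _ => ?_
  rw [Finset.prod_mul_distrib, Finset.prod_const, mul_pow,
    mul_div_mul_left _ _ (pow_ne_zero _ hz)]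

theorem prod_parts {M : Type*} [CommMonoid M] {a : Finset Ω} (p : Finpartition a) (u : Ω → M) :
    ∏ c ∈ p.parts, ∏ j ∈ c, u j = ∏ j ∈ a, u j := by
  have h := Finset.prod_biUnion (s := p.parts) (t := id) (f := u) p.disjoint
  rw [p.biUnion_parts] at h
  exact h.symm

/-- The parts of any partition cover `a` exactly once, so all terms carry the same weight. -/
theorem logStar_prod_mul (u : Ω → ℂ) (f : Finset Ω → ℂ) {a : Finset Ω} (ha : a.Nonempty) :
    logStar (fun c => (∏ j ∈ c, u j) * f c) a = (∏ j ∈ a, u j) * logStar f a := by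
  rw [logStar_of_ne_empty _ ha.ne_empty, logStar_of_ne_empty _ ha.ne_empty, Finset.mul_sum]
  refine Finset.sum_congr rfl fun p _ => ?_
  rw [Finset.prod_mul_distrib, prod_parts p u, Finset.prod_empty, one_mul]
  ring

theorem logStar_conj (f : Finset Ω → ℂ) {a : Finset Ω} (ha : a.Nonempty) :
    logStar (fun c => starRingEnd ℂ (f c)) a = starRingEnd ℂ (logStar f a) := by
  rw [logStar_of_ne_empty _ ha.ne_empty, logStar_of_ne_empty _ ha.ne_empty, map_sum]
  refine Finset.sum_congr rfl fun p _ => ?_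
  simp

end Cumulants

/-! ### Operators on tensor products -/

section Bipartite

variable {P : Type v} {S : Type w} [NormedAddCommGroup P] [InnerProductSpace ℂ P]
  [NormedAddCommGroup S] [InnerProductSpace ℂ S]

theorem opTensor_tensorRight (B : P →L[ℂ] P) (A : S →L[ℂ] S) (e : S) (x : P) :
    opTensor B A (tensorRight e x) = tensorRight (A e) (B x) :=
  ContinuousLinearMap.completion_apply_coe (TensorProduct.mapL B A) (x ⊗ₜ[ℂ] e)

theorem inner_tensorRight (e e' : S) (x x' : P) :
    ⟪(tensorRight e x : Bipartite P S), tensorRight e' x'⟫_ℂ = ⟪x, x'⟫_ℂ * ⟪e, e'⟫_ℂ :=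
  Completion.inner_coe (x ⊗ₜ[ℂ] e : P ⊗[ℂ] S) (x' ⊗ₜ[ℂ] e')

theorem tensorRight_add (e e' : S) :
    (tensorRight (e + e') : P →L[ℂ] Bipartite P S) = tensorRight e + tensorRight e' := by
  simp only [tensorRight, map_add]
  exact ContinuousLinearMap.comp_add _ _ _

theorem tensorRight_smul (c : ℂ) (e : S) :
    (tensorRight (c • e) : P →L[ℂ] Bipartite P S) = c • tensorRight e := by
  simp only [tensorRight, map_smul]
  exact ContinuousLinearMap.comp_smul _ _ _

/-- No closure under scalars is required, because a scalar is absorbed by a factor of an elementary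
tensor. -/
theorem Bipartite.dense_induction {p : Bipartite P S → Prop} (hp : IsClosed {z | p z})
    (h0 : p 0) (hadd : ∀ z z', p z → p z' → p (z + z')) (ht : ∀ e x, p (tensorRight e x)) :
    ∀ z, p z := by
  refine fun z => Completion.induction_on (α := P ⊗[ℂ] S) (p := p) z hp fun t => ?_
  induction t using TensorProduct.induction_on with
  | zero => rw [Completion.coe_zero]; exact h0
  | tmul x e => exact ht e x
  | add t t' h h' => rw [Completion.coe_add]; exact hadd _ _ h h'

theorem Bipartite.clm_ext {F : Type*} [NormedAddCommGroup F] [NormedSpace ℂ F]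
    {T T' : Bipartite P S →L[ℂ] F} (h : ∀ e x, T (tensorRight e x) = T' (tensorRight e x)) :
    T = T' := by
  refine ContinuousLinearMap.ext (Bipartite.dense_induction
    (isClosed_eq T.continuous T'.continuous) (by simp) (fun z z' hz hz' => ?_) h)
  rw [map_add, map_add, hz, hz']

theorem opTensor_smul_left (c : ℂ) (B : P →L[ℂ] P) (A : S →L[ℂ] S) :
    opTensor (c • B) A = c • opTensor B A :=
  Bipartite.clm_ext fun e x => by simp [opTensor_tensorRight]

theorem opTensor_add_right (B : P →L[ℂ] P) (A A' : S →L[ℂ] S) :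
    opTensor B (A + A') = opTensor B A + opTensor B A' :=
  Bipartite.clm_ext fun e x => by simp [opTensor_tensorRight, tensorRight_add]

theorem opTensor_smul_right (c : ℂ) (B : P →L[ℂ] P) (A : S →L[ℂ] S) :
    opTensor B (c • A) = c • opTensor B A :=
  Bipartite.clm_ext fun e x => by simp [opTensor_tensorRight, tensorRight_smul]

theorem opTensor_mul (B B' : P →L[ℂ] P) (A A' : S →L[ℂ] S) :
    opTensor (B * B') (A * A') = opTensor B A * opTensor B' A' :=
  Bipartite.clm_ext fun e x => by simp [opTensor_tensorRight]

theorem opTensor_one : opTensor (1 : P →L[ℂ] P) (1 : S →L[ℂ] S) = 1 :=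
  Bipartite.clm_ext fun e x => by simp [opTensor_tensorRight]

/-- The bound makes `A ↦ B ⊗ A` continuous, so that it passes through exponentials and integrals. -/
theorem norm_opTensor_le (B : P →L[ℂ] P) (A : S →L[ℂ] S) : ‖opTensor B A‖ ≤ ‖B‖ * ‖A‖ := by
  refine ContinuousLinearMap.opNorm_le_bound _ (by positivity) fun z => ?_
  refine Completion.induction_on (α := P ⊗[ℂ] S)
    (p := fun z : Bipartite P S => ‖opTensor B A z‖ ≤ ‖B‖ * ‖A‖ * ‖z‖) z ?_ fun t => ?_
  · exact isClosed_le (opTensor B A).continuous.norm (continuous_norm.const_mul _)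
  · have h1 : opTensor B A ((t : Completion (P ⊗[ℂ] S)) : Bipartite P S) =
        ((TensorProduct.mapL B A t : P ⊗[ℂ] S) : Completion (P ⊗[ℂ] S)) :=
      ContinuousLinearMap.completion_apply_coe (TensorProduct.mapL B A) t
    have h2 : ‖((t : Completion (P ⊗[ℂ] S)) : Bipartite P S)‖ = ‖t‖ := Completion.norm_coe t
    have h3 : ‖opTensor B A ((t : Completion (P ⊗[ℂ] S)) : Bipartite P S)‖ =
        ‖TensorProduct.mapL B A t‖ := by rw [h1]; exact Completion.norm_coe _
    refine h3.trans_le (le_of_le_of_eq ?_ (congrArg (‖B‖ * ‖A‖ * ·) h2.symm))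
    exact (ContinuousLinearMap.le_opNorm _ _).trans
      (mul_le_mul_of_nonneg_right (TensorProduct.norm_mapL_le B A) (norm_nonneg _))

variable (S) in
/-- The map `A ↦ B ⊗ A` as a bounded linear map. -/
def opTensorL (B : P →L[ℂ] P) : (S →L[ℂ] S) →L[ℂ] (Bipartite P S →L[ℂ] Bipartite P S) :=
  LinearMap.mkContinuous
    { toFun := opTensor B
      map_add' := opTensor_add_right B
      map_smul' := fun c A => opTensor_smul_right c B A } ‖B‖ (norm_opTensor_le B)

variable (P S) in
/-- The algebra homomorphism `A ↦ 1 ⊗ A`. -/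
def opTensorHom : (S →L[ℂ] S) →ₐ[ℂ] (Bipartite P S →L[ℂ] Bipartite P S) :=
  AlgHom.ofLinearMap (opTensorL S (1 : P →L[ℂ] P)).toLinearMap opTensor_one fun A A' =>
    (congrArg (opTensor · (A * A')) (mul_one 1).symm).trans (opTensor_mul 1 1 A A')

/-- A continuous algebra homomorphism commutes with the exponential. -/
theorem exp_opTensor_one [CompleteSpace S] (A : S →L[ℂ] S) :
    NormedSpace.exp (opTensor (1 : P →L[ℂ] P) A) = opTensor 1 (NormedSpace.exp A) := by
  let : NormedAlgebra ℚ (S →L[ℂ] S) := NormedAlgebra.restrictScalars ℚ ℂ _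
  let : NormedAlgebra ℚ (Bipartite P S →L[ℂ] Bipartite P S) :=
    NormedAlgebra.restrictScalars ℚ ℂ _
  exact (NormedSpace.map_exp (opTensorHom P S) (opTensorL S (1 : P →L[ℂ] P)).continuous A).symm

variable (P S) in
/-- The map `e ↦ (x ↦ x ⊗ e)` as a bounded linear map. -/
def tensorRightL : S →L[ℂ] (P →L[ℂ] Bipartite P S) :=
  (ContinuousLinearMap.compL ℂ P (P ⊗[ℂ] S) (Bipartite P S) Completion.toComplL) ∘L
    (TensorProduct.mkL ℂ P S).flip

theorem tensorRightL_apply (e : S) : tensorRightL P S e = tensorRight e := rfl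

variable [CompleteSpace P]

theorem adjoint_tensorRight_tensorRight (e e' : S) (x : P) :
    ContinuousLinearMap.adjoint (tensorRight e : P →L[ℂ] Bipartite P S) (tensorRight e' x) =
      ⟪e, e'⟫_ℂ • x := by
  refine ext_inner_left ℂ fun y => ?_
  rw [ContinuousLinearMap.adjoint_inner_right, inner_tensorRight, inner_smul_right, mul_comm]

theorem opTensor_one_ketbra (e : S) :
    opTensor (1 : P →L[ℂ] P) (ketbra e) =
      tensorRight e ∘L ContinuousLinearMap.adjoint (tensorRight e) :=
  Bipartite.clm_ext fun e' x => by
    simp [opTensor_tensorRight, adjoint_tensorRight_tensorRight, ketbra, tensorRight_smul]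

variable [CompleteSpace S]

theorem star_opTensor (B : P →L[ℂ] P) (A : S →L[ℂ] S) :
    star (opTensor B A) = opTensor (star B) (star A) := by
  rw [ContinuousLinearMap.star_eq_adjoint, eq_comm, ContinuousLinearMap.eq_adjoint_iff]
  intro z z'
  refine Bipartite.dense_induction
    (p := fun z => ⟪opTensor (star B) (star A) z, z'⟫_ℂ = ⟪z, opTensor B A z'⟫_ℂ)
    (isClosed_eq (by fun_prop) (by fun_prop)) (by simp)
    (fun z₁ z₂ h₁ h₂ => by simp [h₁, h₂]) (fun e x => ?_) z
  refine Bipartite.dense_induction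
    (p := fun z' => ⟪opTensor (star B) (star A) (tensorRight e x), z'⟫_ℂ =
      ⟪tensorRight e x, opTensor B A z'⟫_ℂ)
    (isClosed_eq (by fun_prop) (by fun_prop)) (by simp)
    (fun z₁ z₂ h₁ h₂ => by simp [h₁, h₂]) (fun e' x' => ?_) z'
  simp only [opTensor_tensorRight, inner_tensorRight, ContinuousLinearMap.star_eq_adjoint,
    ContinuousLinearMap.adjoint_inner_left]

/-- This is Parseval's identity in the chosen basis. -/
theorem trace_rankOne (x y : S) : trace (InnerProductSpace.rankOne ℂ x y) = ⟪y, x⟫_ℂ := by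
  rw [trace, ← (chosenBasis S).tsum_inner_mul_inner y x]
  refine tsum_congr fun i => ?_
  simp

/-- The partial trace of `|x ⊗ e⟩⟨ζ|` is `|x⟩⟨(1 ⊗ ⟨e|) ζ|`. -/
theorem partialTrace_rankOne (e : S) (x : P) (ζ : Bipartite P S) :
    partialTrace (InnerProductSpace.rankOne ℂ (tensorRight e x) ζ) =
      InnerProductSpace.rankOne ℂ x (ContinuousLinearMap.adjoint (tensorRight e) ζ) := by
  have h1 := (chosenBasis S).hasSum_repr e
  have h2 := h1.mapL (tensorRightL P S)
  -- The adjoint and the second slot of `rankOne` are both conjugate linear, so the basis expansion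
  -- of `e` passes through them with its coefficients restored.
  have h3 := (ContinuousLinearMap.adjoint (𝕜 := ℂ) (E := P)
    (F := Bipartite P S)).toContinuousLinearEquiv.toContinuousLinearMap.hasSum h2
  have h4 := h3.mapL ((ContinuousLinearMap.apply ℂ P ζ))
  have h5 := h4.mapL (InnerProductSpace.rankOne ℂ x)
  refine Eq.trans (tsum_congr fun i => ?_) h5.tsum_eq
  refine ContinuousLinearMap.ext fun y => ?_
  simp [tensorRightL_apply, adjoint_tensorRight_tensorRight, HilbertBasis.repr_apply_apply,
    smul_smul, ContinuousLinearMap.adjoint_inner_left, mul_comm]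

end Bipartite

/-! ### Product operators on the space of the pointers. -/

section PiTensor

variable {Ω : Type u} [Fintype Ω] {H : Ω → Type v} [∀ j, NormedAddCommGroup (H j)]
  [∀ j, InnerProductSpace ℂ (H j)]

theorem HilbertTensor.dense_induction {p : HilbertTensor H → Prop} (hp : IsClosed {z | p z})
    (h0 : p 0) (hadd : ∀ z z', p z → p z' → p (z + z')) (hsmul : ∀ (c : ℂ) z, p z → p (c • z))
    (ht : ∀ x, p (productVector x)) : ∀ z, p z := by
  refine fun z => Completion.induction_on (α := PreTensor H) (p := p) z hp fun t => ?_
  obtain ⟨c, rfl⟩ := PreTensor.exists_rep t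
  induction c.support using Finset.cons_induction with
  | empty => rw [Finset.sum_empty, Completion.coe_zero]; exact h0
  | cons x s hx ih =>
    rw [Finset.sum_cons, Completion.coe_add, Completion.coe_smul]
    exact hadd _ _ (hsmul _ _ (ht x)) ih

theorem HilbertTensor.clm_ext {F : Type*} [NormedAddCommGroup F] [NormedSpace ℂ F]
    {T T' : HilbertTensor H →L[ℂ] F} (h : ∀ x, T (productVector x) = T' (productVector x)) :
    T = T' := by
  refine ContinuousLinearMap.ext (HilbertTensor.dense_induction
    (isClosed_eq T.continuous T'.continuous) (by simp) (fun z z' hz hz' => ?_)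
    (fun c z hz => ?_) h)
  · rw [map_add, map_add, hz, hz']
  · rw [map_smul, map_smul, hz]

theorem tensorOp_one : tensorOp (fun j => (1 : H j →L[ℂ] H j)) = 1 :=
  HilbertTensor.clm_ext fun x => by simp [tensorOp_productVector]

theorem star_tensorOp [∀ j, CompleteSpace (H j)] (T : ∀ j, H j →L[ℂ] H j) :
    star (tensorOp T) = tensorOp fun j => star (T j) := by
  rw [ContinuousLinearMap.star_eq_adjoint, eq_comm, ContinuousLinearMap.eq_adjoint_iff]
  intro z z'
  refine HilbertTensor.dense_induction
    (p := fun z => ⟪tensorOp (fun j => star (T j)) z, z'⟫_ℂ = ⟪z, tensorOp T z'⟫_ℂ)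
    (isClosed_eq (by fun_prop) (by fun_prop)) (by simp)
    (fun z₁ z₂ h₁ h₂ => by simp [h₁, h₂])
    (fun c z h => by simp [h]) (fun x => ?_) z
  refine HilbertTensor.dense_induction
    (p := fun z' => ⟪tensorOp (fun j => star (T j)) (productVector x), z'⟫_ℂ =
      ⟪productVector x, tensorOp T z'⟫_ℂ)
    (isClosed_eq (by fun_prop) (by fun_prop)) (by simp)
    (fun z₁ z₂ h₁ h₂ => by simp [h₁, h₂])
    (fun c z h => by simp [h]) (fun x' => ?_) z'
  simp only [tensorOp_productVector, inner_productVector, ContinuousLinearMap.star_eq_adjoint,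
    ContinuousLinearMap.adjoint_inner_left]

variable (H) in
/-- The product vector as a multilinear map. -/
def productVectorMultilinear : MultilinearMap ℂ H (HilbertTensor H) :=
  (Completion.toComplL (𝕜 := ℂ) (E := PreTensor H)).toLinearMap.compMultilinearMap
    (PiTensorProduct.tprod ℂ (s := H) : MultilinearMap ℂ H (PreTensor H))

theorem productVectorMultilinear_apply (x : ∀ j, H j) :
    productVectorMultilinear H x = productVector x := rfl

theorem tensorOp_ketbra (x : ∀ j, H j) :
    tensorOp (fun j => ketbra (x j)) = ketbra (productVector x) := by
  refine HilbertTensor.clm_ext fun y => ?_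
  rw [tensorOp_productVector]
  simp only [ketbra, InnerProductSpace.rankOne_apply, inner_productVector]
  exact (productVectorMultilinear H).map_smul_univ _ _

/-- Expansion of `⊗ (T j + t j)` (with `T j + t j` only for `j ∈ c`). -/
theorem tensorOp_add_smul_one [DecidableEq Ω] (T : ∀ j, H j →L[ℂ] H j) (t : Ω → ℂ)
    (c : Finset Ω) :
    tensorOp (fun j => if j ∈ c then T j + t j • 1 else 1) =
      ∑ b ∈ c.powerset, (∏ j ∈ c \ b, t j) • tensorOp (fun j => if j ∈ b then T j else 1) := by
  refine HilbertTensor.clm_ext fun x => ?_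
  simp only [sum_apply, smul_apply,
    tensorOp_productVector]
  simp only [← productVectorMultilinear_apply]
  have h := (productVectorMultilinear H).map_piecewise_add (fun j => T j (x j))
    (fun j => if j ∈ c then t j • x j else x j) c
  convert h using 1
  · congr 1
    ext j
    by_cases hj : j ∈ c <;> simp [hj]
  · refine Finset.sum_congr rfl fun b hb => ?_
    rw [← MultilinearMap.map_piecewise_smul]
    congr 1
    ext j
    by_cases hj : j ∈ b
    · simp [hj]
    · by_cases hjc : j ∈ c <;> simp [hj, hjc]

end PiTensor

/-! ### The state of the pointers -/

theorem opTensor_ketbra {P : Type v} {S : Type w} [NormedAddCommGroup P] [InnerProductSpace ℂ P]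
    [NormedAddCommGroup S] [InnerProductSpace ℂ S] (x : P) (e : S) :
    opTensor (ketbra x) (ketbra e) = ketbra (tensorRight e x : Bipartite P S) :=
  Bipartite.clm_ext fun e' x' => by
    simp [opTensor_tensorRight, ketbra, inner_tensorRight, tensorRight_smul, smul_smul]

namespace Setup

variable {Ω : Type u} {H : Ω → Type v} {S : Type w} [∀ j, NormedAddCommGroup (H j)]
  [∀ j, InnerProductSpace ℂ (H j)] [NormedAddCommGroup S] [InnerProductSpace ℂ S]
  (W : Setup Ω H S) [Fintype Ω] [DecidableEq Ω]

/-- The initial state of pointers and system. -/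
def initialVector : Bipartite (HilbertTensor H) S := tensorRight W.ψi (productVector W.φ)

/-- The (unnormalized) vector `⟨ψf| e^{-iτH} |φ ⊗ ψi⟩` of the pointers after the postselection. -/
def postselected (γ : Ω → ℝ) : HilbertTensor H :=
  ContinuousLinearMap.adjoint (tensorRight W.ψf)
    (NormedSpace.exp ((-Complex.I * (W.τ : ℂ)) • W.hamiltonian γ) W.initialVector)

/-- The unnormalized expectation of `⊗ T j`, `j ∈ c`, after the postselection. -/
def rawMoment (T : ∀ j, H j →L[ℂ] H j) (γ : Ω → ℝ) (c : Finset Ω) : ℂ :=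
  ⟪W.postselected γ, tensorOp (fun j => if j ∈ c then T j else 1) (W.postselected γ)⟫_ℂ

theorem rawMoment_empty (T : ∀ j, H j →L[ℂ] H j) (γ : Ω → ℝ) :
    W.rawMoment T γ ∅ = ⟪W.postselected γ, W.postselected γ⟫_ℂ := by
  have h := tensorOp_one (H := H)
  simp [rawMoment, h]

/-- Shifting observables by constants multiplies the generating polynomial of the moments by that of
the constants. -/
theorem rawMoment_add_smul_one (T : ∀ j, H j →L[ℂ] H j) (t : Ω → ℂ) (γ : Ω → ℝ) :
    W.rawMoment (fun j => T j + t j • 1) γ =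
      subsetConv (W.rawMoment T γ) (fun c => ∏ j ∈ c, t j) := by
  ext c
  rw [rawMoment, tensorOp_add_smul_one]
  simp only [sum_apply, smul_apply, inner_sum, inner_smul_right, subsetConv, rawMoment]
  exact Finset.sum_congr rfl fun b _ => mul_comm _ _

section SelfAdjoint

variable [∀ j, CompleteSpace (H j)] [CompleteSpace S]

theorem star_siteOp (k : Ω) {T : H k →L[ℂ] H k} (hT : IsSelfAdjoint T) :
    star (siteOp k T : HilbertTensor H →L[ℂ] HilbertTensor H) = siteOp k T := by
  rw [siteOp, star_tensorOp]
  congr 1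
  ext1 j
  by_cases hj : j = k
  · subst hj
    simpa using hT.star_eq
  · simp [hj]

variable {W}

theorem star_hamiltonian (hHS : IsSelfAdjoint W.HS) (hA : ∀ j, IsSelfAdjoint (W.A j))
    (hs : ∀ j, IsSelfAdjoint (W.s j)) (γ : Ω → ℝ) :
    star (W.hamiltonian γ) = W.hamiltonian γ := by
  simp only [hamiltonian, star_add, star_sum, star_smul, star_opTensor, star_one, hHS.star_eq,
    star_siteOp _ (hs _), (hA _).star_eq]
  simp

/-- Since H is self-adjoint, e^{iτH} is the adjoint of e^{-iτH}, so the evolved initial projector is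
again a ketbra; the postselection then acts on its ket alone. -/
theorem unnormalized_eq_rankOne (hHS : IsSelfAdjoint W.HS) (hA : ∀ j, IsSelfAdjoint (W.A j))
    (hs : ∀ j, IsSelfAdjoint (W.s j)) (γ : Ω → ℝ) :
    W.unnormalized γ = InnerProductSpace.rankOne ℂ (tensorRight W.ψf (W.postselected γ))
      (NormedSpace.exp ((-Complex.I * (W.τ : ℂ)) • W.hamiltonian γ) W.initialVector) := by
  have hexp : NormedSpace.exp ((Complex.I * (W.τ : ℂ)) • W.hamiltonian γ) =
      ContinuousLinearMap.adjoint
        (NormedSpace.exp ((-Complex.I * (W.τ : ℂ)) • W.hamiltonian γ)) := by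
    rw [← ContinuousLinearMap.star_eq_adjoint, NormedSpace.star_exp, star_smul,
      star_hamiltonian hHS hA hs]
    simp
  rw [unnormalized, projFinal, projInit, tensorOp_ketbra, opTensor_ketbra, opTensor_one_ketbra,
    hexp]
  refine ContinuousLinearMap.ext fun z => ?_
  simp [ketbra, postselected, initialVector, ContinuousLinearMap.adjoint_inner_right]

theorem pointerMoment_eq (hHS : IsSelfAdjoint W.HS) (hA : ∀ j, IsSelfAdjoint (W.A j))
    (hs : ∀ j, IsSelfAdjoint (W.s j)) (γ : Ω → ℝ) (c : Finset Ω) :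
    W.pointerMoment γ c = (W.rawMoment W.r γ ∅)⁻¹ * W.rawMoment W.r γ c := by
  have h1 : trace (W.unnormalized γ) = W.rawMoment W.r γ ∅ := by
    rw [unnormalized_eq_rankOne hHS hA hs, trace_rankOne, rawMoment_empty,
      ← ContinuousLinearMap.adjoint_inner_left]
    rfl
  have h2 : partialTrace (W.unnormalized γ) =
      InnerProductSpace.rankOne ℂ (W.postselected γ) (W.postselected γ) := by
    rw [unnormalized_eq_rankOne hHS hA hs, partialTrace_rankOne]
    rfl
  rw [pointerMoment, pointerState, h1, h2, mul_smul_comm]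
  have h3 (T : HilbertTensor H →L[ℂ] HilbertTensor H) (z : ℂ) (x y : HilbertTensor H) :
      z • (T * InnerProductSpace.rankOne ℂ x y) = InnerProductSpace.rankOne ℂ (z • T x) y :=
    ContinuousLinearMap.ext fun _ => by simp [smul_smul]
  rw [h3, trace_rankOne, inner_smul_right]
  rfl

end SelfAdjoint

/-! ### Analyticity -/

theorem analyticAt_postselected (γ : Ω → ℝ) : AnalyticAt ℝ W.postselected γ := by
  have hk (k : Ω) : AnalyticAt ℝ (fun γ : Ω → ℝ => ((γ k : ℝ) : ℂ)) γ :=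
    (Complex.ofRealCLM.analyticAt _).comp
      ((ContinuousLinearMap.proj (R := ℝ) (φ := fun _ : Ω => ℝ) k).analyticAt γ)
  have h1 : AnalyticAt ℝ (fun γ => W.hamiltonian γ) γ :=
    analyticAt_const.fun_add
      (Finset.analyticAt_fun_sum _ fun k _ => (hk k).fun_smul analyticAt_const)
  have h2 : AnalyticAt ℝ
      (fun γ => NormedSpace.exp ((-Complex.I * (W.τ : ℂ)) • W.hamiltonian γ)) γ :=
    ((NormedSpace.exp_analytic (𝕂 := ℂ) _).restrictScalars (𝕜 := ℝ)).comp
      (analyticAt_const.fun_smul h1)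
  exact (((ContinuousLinearMap.adjoint (tensorRight W.ψf) ∘L
    ContinuousLinearMap.apply ℂ _ W.initialVector).restrictScalars ℝ).analyticAt _).comp h2

theorem analyticAt_rawMoment (T : ∀ j, H j →L[ℂ] H j) (c : Finset Ω) (γ : Ω → ℝ) :
    AnalyticAt ℝ (fun γ => W.rawMoment T γ c) γ := by
  have h1 := W.analyticAt_postselected γ
  have h2 := (((tensorOp fun j => if j ∈ c then T j else 1).restrictScalars ℝ).analyticAt
    (W.postselected γ)).comp h1
  -- The inner product is conjugate linear in one slot, hence analytic over ℝ; differentiability of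
  -- class ⊤ means analyticity.
  exact (h1.contDiffAt.inner ℂ h2.contDiffAt (n := ⊤)).analyticAt

end Setup

/-! ### The Dyson expansion -/

section Dyson

open MeasureTheory

variable {𝔸 : Type u} [NormedRing 𝔸] [NormedAlgebra ℂ 𝔸]

/-- The evolution `exp (-i t K)`. -/
def evol (K : 𝔸) (t : ℝ) : 𝔸 := NormedSpace.exp ((-Complex.I * (t : ℂ)) • K)

/-- The time-ordered integrals of the Dyson series of `K`, with the operators `B 0, B 1, …` acting
in this order. -/
def dyson (K : 𝔸) : (k : ℕ) → (Fin k → 𝔸) → ℝ → 𝔸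
  | 0, _, t => evol K t
  | k + 1, B, t =>
      ∫ s in 0..t, evol K (t - s) * B (Fin.last k) * dyson K k (fun i => B i.castSucc) s

/-- The remainders of the Dyson series for `exp (-i t (K + V))`. -/
def dysonRem (K V : 𝔸) : ℕ → ℝ → 𝔸
  | 0, t => evol (K + V) t
  | k + 1, t => ∫ s in 0..t, evol K (t - s) * V * dysonRem K V k s

theorem evol_zero (K : 𝔸) : evol K 0 = 1 := by simp [evol]

theorem commute_evol (K : 𝔸) (t : ℝ) : evol K t * K = K * evol K t := by
  have h : Commute (NormedSpace.exp ((-Complex.I * (t : ℂ)) • K)) K :=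
    (((Commute.refl K).smul_left _).exp_left)
  exact h

/-- Only the power of ‖V‖ matters because the series is cut at finite order, so the factor 1/m! can
be given away. -/
theorem norm_dysonRem_le (K V : 𝔸) {T C M : ℝ} (hK : ∀ s ∈ Set.Icc 0 T, ‖evol K s‖ ≤ C)
    (hV : ∀ s ∈ Set.Icc 0 T, ‖evol (K + V) s‖ ≤ M) (m : ℕ) {t : ℝ} (ht : t ∈ Set.Icc 0 T) :
    ‖dysonRem K V m t‖ ≤ (C * ‖V‖ * T) ^ m * M := by
  have hT : 0 ≤ T := ht.1.trans ht.2
  have hC : 0 ≤ C := (norm_nonneg _).trans (hK 0 ⟨le_rfl, hT⟩)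
  have hM : 0 ≤ M := (norm_nonneg _).trans (hV 0 ⟨le_rfl, hT⟩)
  induction m generalizing t with
  | zero => simpa [dysonRem] using hV t ht
  | succ m ih =>
    have h : ∀ s ∈ Set.uIoc 0 t, ‖evol K (t - s) * V * dysonRem K V m s‖ ≤
        C * ‖V‖ * ((C * ‖V‖ * T) ^ m * M) := by
      intro s hs
      rw [Set.uIoc_of_le ht.1] at hs
      have h1 := hK (t - s) ⟨by linarith [hs.2], by linarith [hs.1, ht.2]⟩
      have h2 := ih (t := s) ⟨hs.1.le, hs.2.trans ht.2⟩
      calc _ ≤ ‖evol K (t - s)‖ * ‖V‖ * ‖dysonRem K V m s‖ :=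
            (norm_mul_le _ _).trans (mul_le_mul_of_nonneg_right (norm_mul_le _ _) (norm_nonneg _))
        _ ≤ _ := by gcongr
    refine (intervalIntegral.norm_integral_le_of_norm_le_const h).trans ?_
    rw [sub_zero, abs_of_nonneg ht.1]
    calc _ ≤ C * ‖V‖ * ((C * ‖V‖ * T) ^ m * M) * T := by gcongr; exact ht.2
      _ = _ := by ring

variable [CompleteSpace 𝔸]

theorem continuous_exp_complexAlgebra : Continuous (NormedSpace.exp : 𝔸 → 𝔸) :=
  continuous_iff_continuousAt.2 fun x => (NormedSpace.exp_analytic (𝕂 := ℂ) x).continuousAt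

theorem continuous_evol (K : 𝔸) : Continuous (evol K) := by
  unfold evol
  exact continuous_exp_complexAlgebra.comp (by fun_prop)

theorem continuous_integral_evol_mul (K V : 𝔸) {f : ℝ → 𝔸} (hf : Continuous f) :
    Continuous fun t => ∫ s in 0..t, evol K (t - s) * V * f s := by
  refine intervalIntegral.continuous_parametric_intervalIntegral_of_continuous
    (f := fun t s => evol K (t - s) * V * f s) ?_ continuous_id
  have := continuous_evol K
  simp only [Function.uncurry_def]
  fun_prop

theorem continuous_dyson (K : 𝔸) : ∀ (k : ℕ) (B : Fin k → 𝔸), Continuous (dyson K k B)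
  | 0, _ => continuous_evol K
  | k + 1, B => continuous_integral_evol_mul K _ (continuous_dyson K k fun i => B i.castSucc)

theorem continuous_dysonRem (K V : 𝔸) : ∀ k : ℕ, Continuous (dysonRem K V k)
  | 0 => continuous_evol _
  | k + 1 => continuous_integral_evol_mul K V (continuous_dysonRem K V k)

theorem hasDerivAt_evol (K : 𝔸) (t : ℝ) :
    HasDerivAt (evol K) (-Complex.I • (evol K t * K)) t := by
  have h1 := hasDerivAt_exp_smul_const (𝕂 := ℂ) K (-Complex.I * (t : ℂ))
  have h2 : HasDerivAt (fun s : ℝ => -Complex.I * (s : ℂ)) (-Complex.I) t := by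
    simpa using ((hasDerivAt_id t).ofReal_comp).const_mul (-Complex.I)
  exact h1.scomp t h2

/-- In the derivative of s ↦ e^{-i(t-s)K} e^{-is(K+V)} the terms with K cancel and only V remains;
integrate over [0, t]. -/
theorem duhamel (K V : 𝔸) (t : ℝ) :
    evol (K + V) t = evol K t +
      -Complex.I • ∫ s in 0..t, evol K (t - s) * V * evol (K + V) s := by
  have hd (s : ℝ) : HasDerivAt (fun s => evol K (t - s) * evol (K + V) s)
      (-Complex.I • (evol K (t - s) * V * evol (K + V) s)) s := by
    have h1 : HasDerivAt (fun s => evol K (t - s)) (Complex.I • (evol K (t - s) * K)) s := by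
      simpa using (hasDerivAt_evol K (t - s)).comp_const_sub t s
    convert! h1.mul (hasDerivAt_evol (K + V) s) using 1
    rw [commute_evol (K + V) s]
    simp only [smul_mul_assoc, add_mul, mul_add, smul_add, neg_smul, mul_assoc, mul_neg,
      mul_smul_comm]
    abel
  have hc : Continuous fun s => -Complex.I • (evol K (t - s) * V * evol (K + V) s) := by
    have h1 := continuous_evol K
    have h2 := continuous_evol (K + V)
    fun_prop
  have h := intervalIntegral.integral_eq_sub_of_hasDerivAt (fun s _ => hd s)
    (hc.intervalIntegrable 0 t)
  rw [intervalIntegral.integral_smul] at h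
  rw [h]
  simp [evol_zero]

/-- Duhamel's formula is applied to the full evolution, which sits innermost in the iterated
integral. -/
theorem dysonRem_eq (K V : 𝔸) (k : ℕ) (t : ℝ) :
    dysonRem K V k t = dyson K k (fun _ => V) t + -Complex.I • dysonRem K V (k + 1) t := by
  induction k generalizing t with
  | zero => exact duhamel K V t
  | succ k ih =>
    have h1 := continuous_evol K
    have h2 := continuous_dyson K k fun _ => V
    have h3 := continuous_dysonRem K V (k + 1)
    rw [dysonRem, dyson, dysonRem, ← intervalIntegral.integral_smul,
      ← intervalIntegral.integral_add]
    · refine intervalIntegral.integral_congr fun s _ => ?_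
      rw [ih s, mul_add, mul_smul_comm]
    · exact Continuous.intervalIntegrable (by fun_prop) _ _
    · exact Continuous.intervalIntegrable (by fun_prop) _ _

theorem evol_add_eq_sum (K V : 𝔸) (m : ℕ) (t : ℝ) :
    evol (K + V) t = ∑ k ∈ Finset.range m, (-Complex.I) ^ k • dyson K k (fun _ => V) t +
      (-Complex.I) ^ m • dysonRem K V m t := by
  induction m with
  | zero => simp [dysonRem]
  | succ m ih =>
    rw [ih, dysonRem_eq, Finset.sum_range_succ, smul_add, smul_smul, ← pow_succ, add_assoc]

end Dyson

/-! ### Integrals over simplices -/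

section Simplex

open MeasureTheory

variable {E : Type u} [NormedAddCommGroup E] [NormedSpace ℝ E]

/-- The tuples of `k` interval lengths with sum at most `T`. -/
def simplex (k : ℕ) (T : ℝ) : Set (Fin k → ℝ) := {t | (∀ i, 0 ≤ t i) ∧ ∑ i, t i ≤ T}

theorem isCompact_simplex (k : ℕ) (T : ℝ) : IsCompact (simplex k T) := by
  refine (isCompact_Icc (a := (0 : Fin k → ℝ)) (b := fun _ => T)).of_isClosed_subset ?_ ?_
  · have h : simplex k T = Set.Ici 0 ∩ {t | ∑ i, t i ≤ T} := by
      ext t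
      simp [simplex, Pi.le_def]
    rw [h]
    exact isClosed_Ici.inter (isClosed_le (by fun_prop) (by fun_prop))
  · intro t ht
    exact ⟨ht.1, fun i => (Finset.single_le_sum (fun i _ => ht.1 i) (Finset.mem_univ i)).trans ht.2⟩

/-- Integration over a simplex by slices of fixed total length. -/
theorem integral_simplex_succ (k : ℕ) {τ : ℝ} (hτ : 0 ≤ τ) {G : (Fin (k + 1) → ℝ) → E}
    (hG : Continuous G) :
    ∫ t in simplex (k + 1) τ, G t =
      ∫ T in 0..τ, ∫ t in simplex k T, G (Fin.snoc (α := fun _ => ℝ) t (T - ∑ i, t i)) := by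
  have hcs : Continuous fun p : ℝ × (Fin k → ℝ) => (Fin.snoc (α := fun _ => ℝ) p.2 p.1) := by
    fun_prop
  set g : ℝ × (Fin k → ℝ) → E := fun p =>
    (simplex (k + 1) τ).indicator G (Fin.snoc (α := fun _ => ℝ) p.2 p.1) with hg
  -- The simplex in the coordinates (T, t), where T is the total length and the last length is T - ∑
  -- t_i. Its compactness justifies the exchange of integrals.
  set D : Set (ℝ × (Fin k → ℝ)) := (Set.Icc 0 τ ×ˢ simplex k τ) ∩ {p | ∑ i, p.2 i ≤ p.1} with hD
  have hDc : IsCompact D := (isCompact_Icc.prod (isCompact_simplex k τ)).inter_right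
    (isClosed_le (by fun_prop) (by fun_prop))
  have hsnoc (t : Fin k → ℝ) (x : ℝ) : (Fin.snoc (α := fun _ => ℝ) t x ∈ simplex (k + 1) τ) ↔
      ((∀ i, 0 ≤ t i) ∧ 0 ≤ x) ∧ ∑ i, t i + x ≤ τ := by
    simp [simplex, Fin.sum_univ_castSucc, Fin.forall_fin_succ']
  have hgD (p : ℝ × (Fin k → ℝ)) : g (p.1 - ∑ i, p.2 i, p.2) = D.indicator
      (fun p => G (Fin.snoc (α := fun _ => ℝ) p.2 (p.1 - ∑ i, p.2 i))) p := by
    have hmem : (Fin.snoc (α := fun _ => ℝ) p.2 (p.1 - ∑ i, p.2 i) ∈ simplex (k + 1) τ) ↔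
        p ∈ D := by
      rw [hsnoc, hD]
      simp only [simplex, Set.mem_inter_iff, Set.mem_prod, Set.mem_Icc, Set.mem_ofPred_eq]
      constructor
      · rintro ⟨⟨h1, h2⟩, h3⟩
        have h4 := Finset.sum_nonneg fun i (_ : i ∈ Finset.univ) => h1 i
        exact ⟨⟨⟨by linarith, by linarith⟩, h1, by linarith⟩, by linarith⟩
      · rintro ⟨⟨⟨h1, h2⟩, h3, h4⟩, h5⟩
        exact ⟨⟨h3, by linarith⟩, by linarith⟩
    by_cases h : p ∈ D
    · rw [Set.indicator_of_mem h, hg]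
      exact Set.indicator_of_mem (hmem.2 h) _
    · rw [Set.indicator_of_notMem h, hg]
      exact Set.indicator_of_notMem (fun h' => h (hmem.1 h')) _
  have hintg : Integrable (fun p : ℝ × (Fin k → ℝ) => g (p.1 - ∑ i, p.2 i, p.2))
      (volume.prod volume) := by
    simp only [hgD]
    rw [integrable_indicator_iff hDc.measurableSet]
    exact ContinuousOn.integrableOn_compact hDc (by
      refine Continuous.continuousOn (hG.comp ?_)
      fun_prop)
  have hintg' : Integrable g (volume.prod volume) := by
    have hmem : IntegrableOn G (simplex (k + 1) τ) :=
      hG.continuousOn.integrableOn_compact (isCompact_simplex _ _)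
    rw [← integrable_indicator_iff (isCompact_simplex _ _).measurableSet] at hmem
    have := ((volume_preserving_piFinSuccAbove (fun _ => ℝ)
      (Fin.last k)).symm _).integrable_comp_of_integrable hmem
    convert! this using 1
    ext p
    simp [hg, MeasurableEquiv.piFinSuccAbove, Fin.insertNthEquiv]
  calc ∫ t in simplex (k + 1) τ, G t
      = ∫ t, (simplex (k + 1) τ).indicator G t :=
        (integral_indicator (isCompact_simplex _ _).measurableSet).symm
    _ = ∫ p : ℝ × (Fin k → ℝ), g p := by
        rw [← ((volume_preserving_piFinSuccAbove (fun _ => ℝ) (Fin.last k)).symm _).integral_comp'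
          (g := (simplex (k + 1) τ).indicator G)]
        refine integral_congr_ae (.of_forall fun p => ?_)
        simp [hg, MeasurableEquiv.piFinSuccAbove, Fin.insertNthEquiv]
    _ = ∫ t : Fin k → ℝ, ∫ x : ℝ, g (x, t) := integral_prod_symm _ hintg'
    _ = ∫ t : Fin k → ℝ, ∫ T : ℝ, g (T - ∑ i, t i, t) := by
        refine integral_congr_ae (.of_forall fun t => ?_)
        exact (integral_sub_right_eq_self (fun x => g (x, t)) (∑ i, t i)).symm
    _ = ∫ T : ℝ, ∫ t : Fin k → ℝ, g (T - ∑ i, t i, t) :=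
        (integral_integral_swap (f := fun (T : ℝ) (t : Fin k → ℝ) => g (T - ∑ i, t i, t))
          hintg).symm
    _ = ∫ T, (Set.Icc 0 τ).indicator (fun T => ∫ t in simplex k T,
          G (Fin.snoc (α := fun _ => ℝ) t (T - ∑ i, t i))) T := by
        refine integral_congr_ae (.of_forall fun T => ?_)
        simp only
        by_cases hT : T ∈ Set.Icc 0 τ
        · rw [Set.indicator_of_mem hT, ← integral_indicator (isCompact_simplex _ _).measurableSet]
          refine integral_congr_ae (.of_forall fun t => ?_)
          simp only
          rw [hgD (T, t)]
          have hiff : (T, t) ∈ D ↔ t ∈ simplex k T := by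
            simp only [hD, simplex, Set.mem_inter_iff, Set.mem_prod, Set.mem_ofPred_eq]
            exact ⟨fun h => ⟨h.1.2.1, h.2⟩, fun h => ⟨⟨hT, h.1, h.2.trans hT.2⟩, h.2⟩⟩
          by_cases ht : t ∈ simplex k T
          · rw [Set.indicator_of_mem ht, Set.indicator_of_mem (hiff.2 ht)]
          · rw [Set.indicator_of_notMem ht, Set.indicator_of_notMem fun h => ht (hiff.1 h)]
        · rw [Set.indicator_of_notMem hT]
          refine (integral_congr_ae (.of_forall fun t => ?_)).trans (integral_zero _ _)
          rw [hgD (T, t), Set.indicator_of_notMem fun h => hT h.1.1]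
    _ = _ := by
        rw [integral_indicator measurableSet_Icc, integral_Icc_eq_integral_Ioc,
          intervalIntegral.integral_of_le hτ]

end Simplex

/-! ### The expansion of the state of the pointers -/

/-- The multiplicities of the letters of a word. -/
def letterCount {Ω : Type u} [DecidableEq Ω] {k : ℕ} (v : Fin k → Ω) (j : Ω) : ℕ :=
  (Finset.univ.filter fun i => v i = j).card

theorem letterCount_zero {Ω : Type u} [DecidableEq Ω] (v : Fin 0 → Ω) (j : Ω) :
    letterCount v j = 0 := by
  simp [letterCount]

theorem letterCount_succ {Ω : Type u} [DecidableEq Ω] {k : ℕ} (v : Fin (k + 1) → Ω) (j : Ω) :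
    letterCount v j =
      letterCount (fun i => v i.castSucc) j + if v (Fin.last k) = j then 1 else 0 := by
  simp only [letterCount, Finset.card_filter, Fin.sum_univ_castSucc]

theorem sum_letterCount {Ω : Type u} [Fintype Ω] [DecidableEq Ω] {k : ℕ} (v : Fin k → Ω) :
    ∑ j, letterCount v j = k := by
  have h := Finset.card_eq_sum_card_fiberwise (f := v) (s := Finset.univ) (t := Finset.univ)
    fun _ _ => Finset.mem_coe.2 (Finset.mem_univ _)
  simpa [letterCount] using h.symm

theorem prod_word {Ω : Type u} [Fintype Ω] [DecidableEq Ω] {M : Type*} [CommMonoid M] {k : ℕ}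
    (v : Fin k → Ω) (f : Ω → M) : ∏ i, f (v i) = ∏ j, f j ^ letterCount v j := by
  rw [← Finset.prod_fiberwise Finset.univ v]
  refine Finset.prod_congr rfl fun j _ => ?_
  rw [letterCount, ← Finset.prod_const]
  exact Finset.prod_congr rfl fun i hi => by rw [(Finset.mem_filter.1 hi).2]

theorem evol_opTensor_one {P : Type v} {S : Type w} [NormedAddCommGroup P] [InnerProductSpace ℂ P]
    [NormedAddCommGroup S] [InnerProductSpace ℂ S] [CompleteSpace S] (K : S →L[ℂ] S) (t : ℝ) :
    evol (opTensor (1 : P →L[ℂ] P) K) t = opTensor 1 (evol K t) := by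
  rw [evol, ← opTensor_smul_right, exp_opTensor_one, evol]

namespace Setup

open MeasureTheory

variable {Ω : Type u} {H : Ω → Type v} {S : Type w} [∀ j, NormedAddCommGroup (H j)]
  [∀ j, InnerProductSpace ℂ (H j)] [NormedAddCommGroup S] [InnerProductSpace ℂ S]
  (W : Setup Ω H S)

theorem sysEvol_eq_evol (t : ℝ) : W.sysEvol t = evol W.HS t := rfl

/-! ### Sequential weak values as Dyson integrals of the system. -/

section System

variable [CompleteSpace S]

theorem continuous_sequentialOp : ∀ (k : ℕ) (B : Fin k → S →L[ℂ] S),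
    Continuous (W.sequentialOp k B)
  | 0, _ => (continuous_evol W.HS).comp (continuous_apply 0)
  | k + 1, B => by
    have h1 := (continuous_evol W.HS).comp (continuous_apply (A := fun _ => ℝ) (Fin.last (k + 1)))
    have h2 := (continuous_sequentialOp k fun i => B i.castSucc).comp
      (g := W.sequentialOp k fun i => B i.castSucc)
      (f := fun (t : Fin (k + 2) → ℝ) (i : Fin (k + 1)) => t i.castSucc) (by fun_prop)
    exact (h1.mul continuous_const).mul h2

/-- If s is the total of all lengths but the last, the last interval has length T - s; slicing the
simplex by s reproduces the recursion of `dyson`. -/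
theorem integral_sequentialOp (k : ℕ) (B : Fin k → S →L[ℂ] S) {T : ℝ} (hT : 0 ≤ T) :
    ∫ t in simplex k T, W.sequentialOp k B (Fin.snoc (α := fun _ => ℝ) t (T - ∑ i, t i)) =
      dyson W.HS k B T := by
  induction k generalizing T with
  | zero =>
    have h : simplex 0 T = Set.univ := by
      ext t
      simp [simplex, hT]
    rw [h, Measure.restrict_univ, Measure.volume_pi_eq_dirac, integral_dirac]
    simp [sequentialOp, dyson, sysEvol_eq_evol, Fin.snoc]
  | succ k ih =>
    have hc : Continuous fun t : Fin (k + 1) → ℝ => W.sequentialOp (k + 1) B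
        (Fin.snoc (α := fun _ => ℝ) t (T - ∑ i, t i)) :=
      (W.continuous_sequentialOp _ _).comp (by fun_prop)
    rw [integral_simplex_succ k hT hc, dyson]
    refine intervalIntegral.integral_congr fun s hs => ?_
    rw [Set.uIcc_of_le hT] at hs
    rw [← ih (fun i => B i.castSucc) hs.1]
    have hintg : IntegrableOn (fun t : Fin k → ℝ => W.sequentialOp k (fun i => B i.castSucc)
        (Fin.snoc (α := fun _ => ℝ) t (s - ∑ i, t i))) (simplex k s) :=
      ((W.continuous_sequentialOp _ _).comp (by fun_prop)).continuousOn.integrableOn_compact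
        (isCompact_simplex _ _)
    rw [← integral_const_mul_of_integrable hintg]
    refine integral_congr_ae (.of_forall fun t => ?_)
    simp only [sequentialOp, Fin.snoc_last, Fin.snoc_castSucc, Fin.sum_univ_castSucc,
      sysEvol_eq_evol]
    congr 3
    ring

variable [DecidableEq Ω]

theorem avgWeakValue_eq (hτ : 0 < W.τ) (a : Finset Ω) :
    W.avgWeakValue a = ((W.τ : ℂ) ^ a.card)⁻¹ * ∑ e : Fin a.card ≃ a,
      ⟪W.ψf, dyson W.HS a.card (fun i => W.A (e i)) W.τ W.ψi⟫_ℂ /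
        ⟪W.ψf, W.sysEvol W.τ W.ψi⟫_ℂ := by
  rw [avgWeakValue]
  congr 1
  refine Finset.sum_congr rfl fun e _ => ?_
  have hintg : IntegrableOn (fun t : Fin a.card → ℝ => W.sequentialOp a.card (fun i => W.A (e i))
      (Fin.snoc (α := fun _ => ℝ) t (W.τ - ∑ i, t i))) (simplex a.card W.τ) :=
    ((W.continuous_sequentialOp _ _).comp (by fun_prop)).continuousOn.integrableOn_compact
      (isCompact_simplex _ _)
  have h := ContinuousLinearMap.integral_comp_comm
    (innerSL ℂ W.ψf ∘L ContinuousLinearMap.apply ℂ S W.ψi) hintg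
  rw [W.integral_sequentialOp _ _ hτ.le] at h
  simp only [seqWeakValue]
  rw [integral_div]
  congr 1

end System

/-! ### Word expansion of the postselected pointer vector. -/

section Pointers

variable [Fintype Ω] [DecidableEq Ω]

theorem siteOp_productVector (k : Ω) (T : H k →L[ℂ] H k) (x : ∀ j, H j) :
    siteOp k T (productVector x) = productVector (Function.update x k (T (x k))) := by
  rw [siteOp, tensorOp_productVector]
  congr 1
  ext1 j
  by_cases hj : j = k
  · subst hj
    simp
  · simp [hj]

/-- The product of the pointer operators along a word. -/
def siteWord : (k : ℕ) → (Fin k → Ω) → HilbertTensor H →L[ℂ] HilbertTensor H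
  | 0, _ => 1
  | k + 1, v => siteOp (v (Fin.last k)) (W.s _) * siteWord k (fun i => v i.castSucc)

/-- The product vector `⊗ s j ^ n j φ j`. -/
def excited (n : Ω → ℕ) : HilbertTensor H := productVector fun j => (W.s j ^ n j) (W.φ j)

/-- Operators on different sites act independently, so the pointers retain only the multiplicities
of a word; its order is felt by the system factor alone. -/
theorem siteWord_apply (k : ℕ) (v : Fin k → Ω) :
    W.siteWord k v (productVector W.φ) = W.excited (letterCount v) := by
  induction k with
  | zero => simp [siteWord, excited, letterCount_zero]
  | succ k ih =>
    rw [siteWord, mul_apply_eq_comp, ih, excited, siteOp_productVector, excited]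
    congr 1
    ext1 j
    by_cases hj : j = v (Fin.last k)
    · subst hj
      simp [letterCount_succ v, pow_succ']
    · simp [letterCount_succ v, hj, Ne.symm hj]

/-- The interaction part of the Hamiltonian. -/
def interaction (γ : Ω → ℝ) : Bipartite (HilbertTensor H) S →L[ℂ] Bipartite (HilbertTensor H) S :=
  ∑ k, ((γ k : ℂ) * (W.τ : ℂ)⁻¹) • opTensor (siteOp k (W.s k)) (W.A k)

theorem hamiltonian_eq (γ : Ω → ℝ) :
    W.hamiltonian γ = opTensor 1 W.HS + W.interaction γ := by
  simp only [hamiltonian, interaction, opTensor_smul_left, smul_smul]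

theorem exists_norm_interaction_le : ∃ C, 0 ≤ C ∧ ∀ γ, ‖W.interaction γ‖ ≤ C * ‖γ‖ := by
  refine ⟨∑ k, ‖(W.τ : ℂ)⁻¹‖ * ‖opTensor (siteOp k (W.s k)) (W.A k)‖, by positivity, fun γ => ?_⟩
  rw [Finset.sum_mul]
  refine (norm_sum_le _ _).trans (Finset.sum_le_sum fun k _ => ?_)
  rw [norm_smul, norm_mul, Complex.norm_real]
  have := norm_le_pi_norm γ k
  calc _ ≤ ‖γ‖ * ‖(W.τ : ℂ)⁻¹‖ * ‖opTensor (siteOp k (W.s k)) (W.A k)‖ := by gcongr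
    _ = _ := by ring

variable [CompleteSpace S]

/-- The free evolution acts on the system only, so the pointer factors do not depend on time and
leave the integral. -/
theorem dyson_interaction (γ : Ω → ℝ) (k : ℕ) (t : ℝ) :
    dyson (opTensor 1 W.HS) k (fun _ => W.interaction γ) t =
      ∑ v : Fin k → Ω, (∏ i, ((γ (v i) : ℂ) * (W.τ : ℂ)⁻¹)) •
        opTensor (W.siteWord k v) (dyson W.HS k (fun i => W.A (v i)) t) := by
  induction k generalizing t with
  | zero => simp [dyson, evol_opTensor_one, siteWord]
  | succ k ih =>
    have hcont (B : Fin (k + 1) → S →L[ℂ] S) : Continuous fun s =>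
        evol W.HS (t - s) * B (Fin.last k) * dyson W.HS k (fun i => B i.castSucc) s := by
      have h1 := continuous_evol W.HS
      have h2 := continuous_dyson W.HS k fun i => B i.castSucc
      fun_prop
    have hR (v : Fin (k + 1) → Ω) : opTensor (W.siteWord (k + 1) v)
        (dyson W.HS (k + 1) (fun i => W.A (v i)) t) = ∫ s in 0..t,
          opTensor (W.siteWord (k + 1) v) (evol W.HS (t - s) * W.A (v (Fin.last k)) *
            dyson W.HS k (fun i => W.A (v i.castSucc)) s) := by
      have h := (opTensorL S (W.siteWord (k + 1) v)).intervalIntegral_comp_comm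
        ((hcont fun i => W.A (v i)).intervalIntegrable (μ := volume) 0 t)
      exact h.symm
    simp only [hR, ← intervalIntegral.integral_smul]
    rw [← intervalIntegral.integral_finsetSum, dyson]
    · refine intervalIntegral.integral_congr fun s _ => ?_
      -- The outermost interaction supplies the last letter of the word.
      rw [ih, evol_opTensor_one, ← (Fin.snocEquiv fun _ => Ω).sum_comp,
        Fintype.sum_prod_type_right, interaction, Finset.mul_sum]
      refine Finset.sum_congr rfl fun v _ => ?_
      rw [Finset.mul_sum, Finset.sum_mul]
      refine Finset.sum_congr rfl fun j _ => ?_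
      simp only [Fin.snocEquiv_apply, Fin.prod_univ_castSucc, Fin.snoc_castSucc, Fin.snoc_last,
        siteWord, mul_smul_comm, smul_mul_assoc, smul_smul, ← opTensor_mul, one_mul]
      rw [show (Fin.snocEquiv fun _ => Ω) (j, v) (Fin.last k) = j by simp]
    · intro v _
      refine Continuous.intervalIntegrable (Continuous.fun_const_smul ?_ _) _ _
      exact (opTensorL S (W.siteWord (k + 1) v)).continuous.comp (hcont fun i => W.A (v i))

/-- The amplitude of a word in the Dyson series. -/
def wordAmplitude (k : ℕ) (v : Fin k → Ω) : ℂ :=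
  (-Complex.I * (W.τ : ℂ)⁻¹) ^ k * ⟪W.ψf, dyson W.HS k (fun i => W.A (v i)) W.τ W.ψi⟫_ℂ

/-- The sum of the words of length less than `m` in the Dyson series of `W.postselected γ`. -/
def truncated (m : ℕ) (γ : Ω → ℝ) : HilbertTensor H :=
  ∑ x ∈ (Finset.range m).sigma fun k => (Finset.univ : Finset (Fin k → Ω)),
    ((∏ j, (γ j : ℂ) ^ letterCount x.2 j) * W.wordAmplitude x.1 x.2) •
      W.excited (letterCount x.2)

theorem postselected_eq (m : ℕ) (γ : Ω → ℝ) :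
    W.postselected γ = W.truncated m γ +
      (-Complex.I) ^ m • ContinuousLinearMap.adjoint (tensorRight W.ψf)
        (dysonRem (opTensor 1 W.HS) (W.interaction γ) m W.τ W.initialVector) := by
  have h := evol_add_eq_sum (opTensor (1 : HilbertTensor H →L[ℂ] HilbertTensor H) W.HS)
    (W.interaction γ) m W.τ
  rw [← hamiltonian_eq, evol] at h
  rw [postselected, h, add_apply, map_add, smul_apply, map_smul]
  congr 1
  rw [truncated, Finset.sum_sigma, sum_apply, map_sum]
  refine Finset.sum_congr rfl fun k _ => ?_
  rw [dyson_interaction, smul_apply, map_smul, sum_apply, map_sum, Finset.smul_sum]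
  refine Finset.sum_congr rfl fun v _ => ?_
  rw [smul_apply, map_smul, initialVector, opTensor_tensorRight,
    adjoint_tensorRight_tensorRight, siteWord_apply, smul_smul, smul_smul, Finset.prod_mul_distrib,
    prod_word v fun j => (γ j : ℂ), wordAmplitude]
  congr 1
  simp only [Finset.prod_const, Finset.card_univ, Fintype.card_fin]
  ring

/-- The remainder contains m interactions, each O(‖γ‖). The full evolution is bounded uniformly by
compactness of the unit ball times [0, τ]. -/
theorem postselected_sub_truncated (hτ : 0 < W.τ) (m : ℕ) :
    (fun γ => W.postselected γ - W.truncated m γ) =O[nhds 0] fun γ => ‖γ‖ ^ m := by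
  obtain ⟨C, hC0, hC⟩ := W.exists_norm_interaction_le
  have hcH : Continuous W.hamiltonian := by
    unfold hamiltonian
    fun_prop
  have hcU : Continuous fun p : (Ω → ℝ) × ℝ => evol (W.hamiltonian p.1) p.2 := by
    unfold evol
    exact continuous_exp_complexAlgebra.comp (by fun_prop)
  obtain ⟨M, hM⟩ := ((isCompact_closedBall (0 : Ω → ℝ) 1).prod
    (isCompact_Icc (a := 0) (b := W.τ))).exists_bound_of_continuousOn hcU.continuousOn
  obtain ⟨N, hN⟩ := (isCompact_Icc (a := 0) (b := W.τ)).exists_bound_of_continuousOn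
    (continuous_evol (opTensor (1 : HilbertTensor H →L[ℂ] HilbertTensor H) W.HS)).continuousOn
  have hN0 : 0 ≤ N := (norm_nonneg _).trans (hN 0 ⟨le_rfl, hτ.le⟩)
  have hM0 : 0 ≤ M := (norm_nonneg _).trans
    (hM (0, 0) ⟨Metric.mem_closedBall_self zero_le_one, le_rfl, hτ.le⟩)
  set L := ContinuousLinearMap.adjoint
    (tensorRight W.ψf : HilbertTensor H →L[ℂ] Bipartite (HilbertTensor H) S)
  refine Asymptotics.IsBigO.of_bound (‖L‖ * ((N * C * W.τ) ^ m * M * ‖W.initialVector‖)) ?_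
  filter_upwards [Metric.closedBall_mem_nhds (0 : Ω → ℝ) zero_lt_one] with γ hγ
  have hrem := norm_dysonRem_le (opTensor (1 : HilbertTensor H →L[ℂ] HilbertTensor H) W.HS)
    (W.interaction γ) (T := W.τ) hN (M := M)
    (fun s hs => by rw [← hamiltonian_eq]; exact hM (γ, s) ⟨hγ, hs⟩) m ⟨hτ.le, le_rfl⟩
  rw [W.postselected_eq m γ, add_sub_cancel_left, norm_smul, norm_pow, norm_neg, Complex.norm_I,
    one_pow, one_mul, norm_pow, norm_norm]
  have hpow : (N * ‖W.interaction γ‖ * W.τ) ^ m ≤ (N * C * W.τ) ^ m * ‖γ‖ ^ m := by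
    rw [← mul_pow]
    refine pow_le_pow_left₀ (by positivity) ?_ m
    calc _ ≤ N * (C * ‖γ‖) * W.τ := by gcongr; exact hC γ
      _ = _ := by ring
  calc _ ≤ ‖L‖ * (‖dysonRem (opTensor 1 W.HS) (W.interaction γ) m W.τ‖ * ‖W.initialVector‖) :=
        (L.le_opNorm _).trans (mul_le_mul_of_nonneg_left
          (ContinuousLinearMap.le_opNorm _ _) (norm_nonneg _))
    _ ≤ ‖L‖ * (((N * C * W.τ) ^ m * ‖γ‖ ^ m) * M * ‖W.initialVector‖) := by
        gcongr
        exact hrem.trans (by gcongr)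
    _ = _ := by ring

end Pointers

end Setup

/-! ### Lowest order asymptotics -/

section Asymptotics

open Asymptotics Filter Topology

variable {Ω : Type u} [Fintype Ω]

theorem isBigO_norm_pow {m n : ℕ} (h : n ≤ m) :
    (fun γ : Ω → ℝ => ‖γ‖ ^ m) =O[𝓝 0] fun γ => ‖γ‖ ^ n := by
  refine IsBigO.of_bound 1 ?_
  filter_upwards [Metric.closedBall_mem_nhds (0 : Ω → ℝ) zero_lt_one] with γ hγ
  rw [mem_closedBall_zero_iff] at hγ
  simpa using pow_le_pow_of_le_one (norm_nonneg γ) hγ h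

theorem isBigO_monomial (n : Ω → ℕ) :
    (fun γ : Ω → ℝ => ∏ j, (γ j : ℂ) ^ n j) =O[𝓝 0] fun γ => ‖γ‖ ^ ∑ j, n j := by
  refine IsBigO.of_bound 1 (.of_forall fun γ => ?_)
  rw [norm_prod, norm_pow, norm_norm, one_mul, ← Finset.prod_pow_eq_pow_sum]
  refine Finset.prod_le_prod (fun j _ => norm_nonneg _) fun j _ => ?_
  rw [norm_pow, Complex.norm_real]
  exact pow_le_pow_left₀ (norm_nonneg _) (norm_le_pi_norm γ j) _

theorem isBigO_prod_coord (c : Finset Ω) (z : ℂ) :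
    (fun γ : Ω → ℝ => (∏ j ∈ c, (γ j : ℂ)) * z) =O[𝓝 0] fun γ => ‖γ‖ ^ c.card := by
  refine IsBigO.of_bound ‖z‖ (.of_forall fun γ => ?_)
  rw [norm_mul, mul_comm, norm_prod, norm_pow, norm_norm, ← Finset.prod_const]
  gcongr with j
  rw [Complex.norm_real]
  exact norm_le_pi_norm γ j

/-- Each factor has size ‖γ‖^|c|, and replacing one factor by its leading term gains one order. -/
theorem isBigO_prod_sub_prod [DecidableEq Ω] {q : (Ω → ℝ) → Finset Ω → ℂ} {k : Finset Ω → ℂ}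
    (h : ∀ c, (fun γ => q γ c - (∏ j ∈ c, (γ j : ℂ)) * k c) =O[𝓝 0] fun γ => ‖γ‖ ^ (c.card + 1))
    (p : Finset (Finset Ω)) :
    (fun γ => ∏ c ∈ p, q γ c - ∏ c ∈ p, ((∏ j ∈ c, (γ j : ℂ)) * k c)) =O[𝓝 0]
      fun γ => ‖γ‖ ^ (∑ c ∈ p, c.card + 1) := by
  have hl (p : Finset (Finset Ω)) : (fun γ : Ω → ℝ => ∏ c ∈ p, ((∏ j ∈ c, (γ j : ℂ)) * k c))
      =O[𝓝 0] fun γ => ‖γ‖ ^ ∑ c ∈ p, c.card := by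
    simp only [← Finset.prod_pow_eq_pow_sum]
    exact IsBigO.finsetProd fun c _ => isBigO_prod_coord c (k c)
  induction p using Finset.induction_on with
  | empty => simpa using isBigO_zero _ _
  | insert c p hc ih =>
    have hq : (fun γ => ∏ c ∈ p, q γ c) =O[𝓝 0] fun γ : Ω → ℝ => ‖γ‖ ^ ∑ c ∈ p, c.card := by
      simpa using (ih.trans (isBigO_norm_pow (Nat.le_succ _))).add (hl p)
    have h1 := (h c).mul hq
    have h2 := (isBigO_prod_coord c (k c)).mul ih
    have e1 (γ : Ω → ℝ) : ‖γ‖ ^ (c.card + 1) * ‖γ‖ ^ ∑ c ∈ p, c.card =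
        ‖γ‖ ^ (∑ c ∈ insert c p, c.card + 1) := by
      rw [← pow_add, Finset.sum_insert hc]; congr 1; ring
    have e2 (γ : Ω → ℝ) : ‖γ‖ ^ c.card * ‖γ‖ ^ (∑ c ∈ p, c.card + 1) =
        ‖γ‖ ^ (∑ c ∈ insert c p, c.card + 1) := by
      rw [← pow_add, Finset.sum_insert hc, add_assoc]
    simp only [e1] at h1
    simp only [e2] at h2
    refine (h1.add h2).congr_left fun γ => ?_
    rw [Finset.prod_insert hc, Finset.prod_insert hc]
    ring

theorem tendsto_of_isBigO_sub {f : (Ω → ℝ) → ℂ} {z : ℂ}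
    (h : (fun γ => f γ - z) =O[𝓝 0] fun γ => ‖γ‖ ^ 1) : Tendsto f (𝓝 0) (𝓝 z) := by
  have h1 : Tendsto (fun γ : Ω → ℝ => ‖γ‖ ^ 1) (𝓝 0) (𝓝 0) := by
    have : Continuous fun γ : Ω → ℝ => ‖γ‖ ^ 1 := by fun_prop
    simpa using this.tendsto 0
  simpa using (h.trans_tendsto h1).add_const z

/-- The lowest order of the cumulants is the cumulant of the lowest orders. -/
theorem isBigO_logStar_sub [DecidableEq Ω] {f : (Ω → ℝ) → Finset Ω → ℂ} {k : Finset Ω → ℂ}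
    (hk : k ∅ ≠ 0)
    (h : ∀ c, (fun γ => f γ c - (∏ j ∈ c, (γ j : ℂ)) * k c) =O[𝓝 0] fun γ => ‖γ‖ ^ (c.card + 1))
    {a : Finset Ω} (ha : a.Nonempty) :
    (fun γ => logStar (f γ) a - (∏ j ∈ a, (γ j : ℂ)) * logStar k a) =O[𝓝 0]
      fun γ => ‖γ‖ ^ (a.card + 1) := by
  have h0 : (fun γ => f γ ∅ - k ∅) =O[𝓝 0] fun γ => ‖γ‖ ^ 1 := by simpa using h ∅
  have hlim := tendsto_of_isBigO_sub h0
  have hinv : (fun γ => (f γ ∅)⁻¹) =O[𝓝 0] fun _ => (1 : ℝ) := (hlim.inv₀ hk).isBigO_one ℝ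
  have hinv' : (fun γ => (f γ ∅)⁻¹ - (k ∅)⁻¹) =O[𝓝 0] fun γ => ‖γ‖ ^ 1 := by
    -- The identity used is f⁻¹ - k⁻¹ = -k⁻¹ (f - k) f⁻¹.
    have h1 := (h0.mul hinv).const_mul_left (-(k ∅)⁻¹)
    simp only [mul_one] at h1
    refine h1.congr' ?_ .rfl
    filter_upwards [hlim.eventually_ne hk] with γ hγ
    field_simp
    ring
  have hq (c : Finset Ω) : (fun γ => f γ c / f γ ∅ - (∏ j ∈ c, (γ j : ℂ)) * (k c / k ∅))
      =O[𝓝 0] fun γ => ‖γ‖ ^ (c.card + 1) := by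
    have h1 := (h c).mul hinv
    have h2 := (isBigO_prod_coord c (k c)).mul hinv'
    simp only [mul_one] at h1
    simp only [← pow_add] at h2
    refine (h1.add h2).congr_left fun γ => ?_
    simp only [div_eq_mul_inv]
    ring
  have hp (p : Finpartition a) := (isBigO_prod_sub_prod hq p.parts).const_mul_left
    ((-1) ^ (p.parts.card - 1) * ((p.parts.card - 1).factorial : ℂ))
  -- The parts of any partition of `a` have |a| elements in total, so all partitions contribute at
  -- the same order.
  simp only [Finpartition.sum_card_parts] at hp
  have hsum := IsBigO.fun_sum (s := (Finset.univ : Finset (Finpartition a))) fun p _ => hp p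
  refine hsum.congr_left fun γ => ?_
  rw [logStar_of_ne_empty _ ha.ne_empty, logStar_of_ne_empty _ ha.ne_empty, Finset.mul_sum,
    ← Finset.sum_sub_distrib]
  refine Finset.sum_congr rfl fun p _ => ?_
  rw [Finset.prod_mul_distrib, prod_parts p fun j => (γ j : ℂ), Finset.prod_div_distrib,
    Finset.prod_div_distrib, Finset.prod_const, Finset.prod_const]
  ring

theorem analyticAt_logStar [DecidableEq Ω] {f : (Ω → ℝ) → Finset Ω → ℂ} {γ : Ω → ℝ}
    (hf : ∀ c, AnalyticAt ℝ (fun γ => f γ c) γ) (h0 : f γ ∅ ≠ 0) {a : Finset Ω}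
    (ha : a.Nonempty) : AnalyticAt ℝ (fun γ => logStar (f γ) a) γ := by
  simp only [logStar_of_ne_empty _ ha.ne_empty]
  refine Finset.analyticAt_fun_sum _ fun p _ => analyticAt_const.fun_mul ?_
  exact (Finset.analyticAt_fun_prod _ fun c _ => hf c).fun_div ((hf ∅).fun_pow _) (pow_ne_zero _ h0)

end Asymptotics

/-! ### Words that use every letter once -/

/-- The multiplicities of the letters of a word that uses the letters in `b` once. -/
def occupation {Ω : Type u} [DecidableEq Ω] (b : Finset Ω) (j : Ω) : ℕ := if j ∈ b then 1 else 0

section Words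

variable {Ω : Type u} [DecidableEq Ω]

theorem sum_occupation [Fintype Ω] (b : Finset Ω) : ∑ j, occupation b j = b.card := by
  simp [occupation]

theorem occupation_injective : Function.Injective (occupation (Ω := Ω)) := by
  intro b b' h
  ext j
  have := congrFun h j
  simp only [occupation] at this
  by_cases hj : j ∈ b <;> by_cases hj' : j ∈ b' <;> simp_all

/-- Splitting a multiplicity function with values in `{0, 1}` means splitting a set. -/
theorem sum_occupation_split (c : Finset Ω) (n' n : Ω → ℕ) [DecidableEq (Ω → ℕ)] (z : ℂ) :
    (if n' + n = occupation c then z else 0) =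
      ∑ b ∈ c.powerset, if n = occupation b then
        (if n' = occupation (c \ b) then z else 0) else 0 := by
  split_ifs with h
  · have hj (j : Ω) : n' j + n j = if j ∈ c then 1 else 0 := congrFun h j
    -- On `c` exactly one of n' and n equals 1; `b` collects the sites where it is n.
    set b := c.filter fun j => n j = 1
    have hn : n = occupation b := by
      ext j
      have := hj j
      by_cases hc : j ∈ c <;> simp [occupation, b, hc] at this ⊢ <;> grind
    have hn' : n' = occupation (c \ b) := by
      ext j
      have := hj j
      by_cases hc : j ∈ c <;> simp [occupation, b, hc] at this ⊢ <;> grind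
    rw [Finset.sum_eq_single b]
    · rw [if_pos hn, if_pos hn']
    · intro b' _ hb'
      rw [if_neg fun h' => hb' (occupation_injective (h'.symm.trans hn))]
    · intro hb
      exact absurd (Finset.mem_powerset.2 (Finset.filter_subset _ _)) hb
  · refine (Finset.sum_eq_zero fun b hb => ?_).symm
    rw [Finset.mem_powerset] at hb
    split_ifs with h1 h2
    · refine absurd ?_ h
      ext j
      have := @hb j
      simp only [h1, h2, Pi.add_apply, occupation, Finset.mem_sdiff]
      by_cases hjb : j ∈ b <;> by_cases hjc : j ∈ c <;> simp_all
    all_goals rfl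

/-- A sum over the words that use the letters in `b` once is a sum over the orderings of `b`. -/
theorem sum_words_eq_sum_equiv [Fintype Ω] [DecidableEq (Ω → ℕ)] (b : Finset Ω)
    (F : (Fin b.card → Ω) → ℂ) :
    ∑ v : Fin b.card → Ω with letterCount v = occupation b, F v =
      ∑ e : Fin b.card ≃ b, F fun i => e i := by
  have hcount (v : Fin b.card → Ω) (hv : Function.Injective v) (hb : ∀ i, v i ∈ b) :
      letterCount v = occupation b := by
    have hle (j : Ω) : letterCount v j ≤ occupation b j := by
      unfold occupation letterCount
      split_ifs with hj
      · refine Finset.card_le_one.2 fun i hi i' hi' => hv ?_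
        rw [(Finset.mem_filter.1 hi).2, (Finset.mem_filter.1 hi').2]
      · refine (Finset.card_eq_zero.2 (Finset.filter_eq_empty_iff.2 fun i _ h => hj ?_)).le
        exact h ▸ hb i
    -- Both multiplicity functions have total |b|, so the pointwise inequality is an equality.
    have hs : ∑ j, letterCount v j = ∑ j, occupation b j := by
      rw [sum_letterCount, sum_occupation]
    ext j
    exact (Finset.sum_eq_sum_iff_of_le fun j _ => hle j).1 hs j (Finset.mem_univ j)
  refine (Finset.sum_bij (fun e _ i => (e i : Ω)) ?_ ?_ ?_ ?_).symm
  · intro e _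
    simp only [Finset.mem_filter, Finset.mem_univ, true_and]
    exact hcount _ (Subtype.val_injective.comp e.injective) fun i => (e i).2
  · intro e _ e' _ h
    ext i
    exact congrFun h i
  · intro v hv
    simp only [Finset.mem_filter, Finset.mem_univ, true_and] at hv
    have hle (j : Ω) : (Finset.univ.filter fun i => v i = j).card = if j ∈ b then 1 else 0 :=
      congrFun hv j
    have hb (i : Fin b.card) : v i ∈ b := by
      by_contra hi
      have := hle (v i)
      rw [if_neg hi, Finset.card_eq_zero] at this
      exact Finset.notMem_empty i (this ▸ by simp)
    have hinj : Function.Injective fun i => (⟨v i, hb i⟩ : b) := by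
      intro i i' h
      have h' : v i = v i' := congrArg Subtype.val h
      have := hle (v i)
      rw [if_pos (hb i)] at this
      exact Finset.card_le_one.1 this.le i (by simp) i' (by simp [h'])
    exact ⟨Equiv.ofBijective _ ((Fintype.bijective_iff_injective_and_card _).2
      ⟨hinj, by simp⟩), Finset.mem_univ _, rfl⟩
  · intro e _
    rfl

end Words

/-! ### The pointer cumulants -/

namespace Setup

open Asymptotics Filter Topology

variable {Ω : Type u} {H : Ω → Type v} {S : Type w} [∀ j, NormedAddCommGroup (H j)]
  [∀ j, InnerProductSpace ℂ (H j)] [NormedAddCommGroup S] [InnerProductSpace ℂ S]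
  (W : Setup Ω H S)

/-- The observable `r j - ⟨r j⟩`. -/
def centered (j : Ω) : H j →L[ℂ] H j := W.r j - W.pointerMean j (W.r j) • 1

/-- The covariance `⟨r j s j⟩ - ⟨r j⟩ ⟨s j⟩`. -/
def covariance (j : Ω) : ℂ :=
  W.pointerMean j (W.r j * W.s j) - W.pointerMean j (W.r j) * W.pointerMean j (W.s j)

/-- The amplitude `⟨ψf| exp (-i τ HS) |ψi⟩`. -/
def overlap : ℂ := ⟪W.ψf, W.sysEvol W.τ W.ψi⟫_ℂ

/-- The cumulant generating part of the lowest order of the moments. -/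
def lowestOrder [DecidableEq Ω] (b : Finset Ω) : ℂ :=
  W.overlap * ((∏ j ∈ b, (-Complex.I * W.covariance j)) * W.avgWeakValue b)

variable {W}

/-- The vanishing mean forces every observed pointer to be excited on at least one side. -/
theorem inner_centered (hφ : ∀ j, ‖W.φ j‖ = 1) (j : Ω) : ⟪W.φ j, W.centered j (W.φ j)⟫_ℂ = 0 := by
  simp [centered, pointerMean, inner_self_eq_norm_sq_to_K, hφ]

theorem inner_centered_s (j : Ω) :
    ⟪W.φ j, W.centered j (W.s j (W.φ j))⟫_ℂ = W.covariance j := by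
  simp [centered, covariance, pointerMean]

/-- Self-adjointness makes both means real and exchanges the order of `r j` and `s j`, so an
excitation of the bra yields the conjugate covariance. -/
theorem inner_s_centered [∀ j, CompleteSpace (H j)] (hr : ∀ j, IsSelfAdjoint (W.r j))
    (hs : ∀ j, IsSelfAdjoint (W.s j)) (j : Ω) :
    ⟪W.s j (W.φ j), W.centered j (W.φ j)⟫_ℂ = starRingEnd ℂ (W.covariance j) := by
  have hr' (x y : H j) : ⟪W.r j x, y⟫_ℂ = ⟪x, W.r j y⟫_ℂ := (hr j).isSymmetric x y
  have hs' (x y : H j) : ⟪W.s j x, y⟫_ℂ = ⟪x, W.s j y⟫_ℂ := (hs j).isSymmetric x y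
  have h1 : starRingEnd ℂ (W.pointerMean j (W.r j)) = W.pointerMean j (W.r j) := by
    rw [pointerMean, inner_conj_symm, hr']
  have h2 : starRingEnd ℂ (W.pointerMean j (W.s j)) = W.pointerMean j (W.s j) := by
    rw [pointerMean, inner_conj_symm, hs']
  rw [covariance, map_sub, map_mul, h1, h2]
  simp only [centered, sub_apply, smul_apply, one_apply_eq_self, inner_sub_right, inner_smul_right]
  rw [hs' _ (W.φ j)]
  congr 1
  rw [pointerMean, inner_conj_symm, mul_apply_eq_comp, hr', hs']

/-! ### Moments of the centred observables to lowest order. -/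

section Moments

variable [Fintype Ω] [DecidableEq Ω]

theorem inner_excited (c : Finset Ω) (n' n : Ω → ℕ) :
    ⟪W.excited n', tensorOp (fun j => if j ∈ c then W.centered j else 1) (W.excited n)⟫_ℂ =
      ∏ j, ⟪(W.s j ^ n' j) (W.φ j),
        (if j ∈ c then W.centered j else 1) ((W.s j ^ n j) (W.φ j))⟫_ℂ := by
  rw [excited, excited, tensorOp_productVector, inner_productVector]

/-- If every site of `c` were excited, a total of at most |c| excitations would leave exactly one at
each. So some observed site is unexcited, and its factor is a centred mean. -/
theorem inner_excited_eq_zero (hφ : ∀ j, ‖W.φ j‖ = 1) {c : Finset Ω} {n' n : Ω → ℕ}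
    (h : n' + n ≠ occupation c) (hcard : ∑ j, n' j + ∑ j, n j ≤ c.card) :
    ⟪W.excited n', tensorOp (fun j => if j ∈ c then W.centered j else 1) (W.excited n)⟫_ℂ = 0 := by
  have hex : ∃ j ∈ c, n' j + n j = 0 := by
    by_contra! hne
    have hle (j : Ω) : occupation c j ≤ n' j + n j := by
      unfold occupation
      split_ifs with hj
      · exact Nat.one_le_iff_ne_zero.2 (hne j hj)
      · exact Nat.zero_le _
    have hsum : ∑ j, occupation c j = ∑ j, (n' j + n j) := by
      refine le_antisymm (Finset.sum_le_sum fun j _ => hle j) ?_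
      rw [sum_occupation, Finset.sum_add_distrib]
      exact hcard
    refine h (funext fun j => ?_)
    exact ((Finset.sum_eq_sum_iff_of_le fun j _ => hle j).1 hsum j (Finset.mem_univ j)).symm
  obtain ⟨j, hj, h0⟩ := hex
  rw [inner_excited]
  refine Finset.prod_eq_zero (Finset.mem_univ j) ?_
  rw [Nat.add_eq_zero_iff] at h0
  rw [h0.1, h0.2, if_pos hj]
  exact inner_centered hφ j

theorem inner_excited_occupation [∀ j, CompleteSpace (H j)] (hr : ∀ j, IsSelfAdjoint (W.r j))
    (hs : ∀ j, IsSelfAdjoint (W.s j)) (hφ : ∀ j, ‖W.φ j‖ = 1) {b c : Finset Ω} (hb : b ⊆ c) :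
    ⟪W.excited (occupation (c \ b)),
      tensorOp (fun j => if j ∈ c then W.centered j else 1) (W.excited (occupation b))⟫_ℂ =
      (∏ j ∈ b, W.covariance j) * ∏ j ∈ c \ b, starRingEnd ℂ (W.covariance j) := by
  have hterm (j : Ω) : ⟪(W.s j ^ occupation (c \ b) j) (W.φ j),
      (if j ∈ c then W.centered j else 1) ((W.s j ^ occupation b j) (W.φ j))⟫_ℂ =
      (if j ∈ b then W.covariance j else 1) *
        (if j ∈ c \ b then starRingEnd ℂ (W.covariance j) else 1) := by
    by_cases hjb : j ∈ b
    · simp [occupation, hjb, hb hjb, inner_centered_s]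
    · by_cases hjc : j ∈ c
      · simp [occupation, hjb, hjc, inner_s_centered hr hs]
      · simp [occupation, hjb, hjc, inner_self_eq_norm_sq_to_K, hφ]
  rw [inner_excited, Finset.prod_congr rfl fun j _ => hterm j, Finset.prod_mul_distrib,
    Finset.prod_ite_mem, Finset.prod_ite_mem, Finset.univ_inter, Finset.univ_inter]

variable [CompleteSpace S]

/-- Such words have length |b| and are the orderings of `b`, and the power of τ⁻¹ in the amplitude
is the prefactor of `avgWeakValue`. -/
theorem sum_wordAmplitude [DecidableEq (Ω → ℕ)] (hτ : 0 < W.τ) (hne : W.overlap ≠ 0) {m : ℕ}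
    (b : Finset Ω) (hb : b.card < m) :
    (∑ x ∈ (Finset.range m).sigma fun k => (Finset.univ : Finset (Fin k → Ω)),
      if letterCount x.2 = occupation b then W.wordAmplitude x.1 x.2 else 0) =
      W.overlap * ((-Complex.I) ^ b.card * W.avgWeakValue b) := by
  rw [Finset.sum_sigma, Finset.sum_eq_single b.card]
  · rw [← Finset.sum_filter, sum_words_eq_sum_equiv b fun v => W.wordAmplitude _ v,
      W.avgWeakValue_eq hτ]
    simp only [wordAmplitude, ← Finset.mul_sum, ← Finset.sum_div, mul_pow, inv_pow]
    change _ = W.overlap * (_ * (_ * (_ / W.overlap)))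
    field_simp
  · intro k _ hk
    refine Finset.sum_eq_zero fun v _ => if_neg fun h => hk ?_
    rw [← sum_letterCount v, ← sum_occupation b]
    simp only [h]
  · intro h
    exact absurd (Finset.mem_range.2 hb) h

theorem rawMoment_centered_isBigO [∀ j, CompleteSpace (H j)] (hτ : 0 < W.τ)
    (hr : ∀ j, IsSelfAdjoint (W.r j)) (hs : ∀ j, IsSelfAdjoint (W.s j))
    (hφ : ∀ j, ‖W.φ j‖ = 1) (hne : W.overlap ≠ 0) (c : Finset Ω) :
    (fun γ => W.rawMoment W.centered γ c - (∏ j ∈ c, (γ j : ℂ)) *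
      subsetConv W.lowestOrder (fun b => starRingEnd ℂ (W.lowestOrder b)) c) =O[𝓝 0]
      fun γ => ‖γ‖ ^ (c.card + 1) := by
  classical
  set T : HilbertTensor H →L[ℂ] HilbertTensor H :=
    tensorOp fun j => if j ∈ c then W.centered j else 1 with hT
  -- Words up to length |c| are kept, so the truncation error already has the required order.
  set m := c.card + 1
  set I := (Finset.range m).sigma fun k => (Finset.univ : Finset (Fin k → Ω)) with hI
  have hO (R : (Ω → ℝ) → HilbertTensor H) :
      (fun γ => T (R γ)) =O[𝓝 0] R := T.isBigO_comp R _
  have hR := W.postselected_sub_truncated hτ m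
  have hχ : W.postselected =O[𝓝 0] fun _ => (1 : ℝ) :=
    (W.analyticAt_postselected 0).continuousAt.tendsto.isBigO_one ℝ
  have hX : W.truncated m =O[𝓝 0] fun _ => (1 : ℝ) := by
    have h1 : (fun γ : Ω → ℝ => ‖γ‖ ^ m) =O[𝓝 0] fun _ => (1 : ℝ) := by
      simpa using isBigO_norm_pow (Ω := Ω) (Nat.zero_le m)
    simpa using hχ.sub (hR.trans h1)
  have hinner {f g : (Ω → ℝ) → HilbertTensor H} {p q : (Ω → ℝ) → ℝ} (hf : f =O[𝓝 0] p)
      (hg : g =O[𝓝 0] q) : (fun γ => ⟪f γ, g γ⟫_ℂ) =O[𝓝 0] fun γ => p γ * q γ :=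
    (IsBigO.of_bound 1 (.of_forall fun γ => by
      simpa using norm_inner_le_norm (𝕜 := ℂ) (f γ) (g γ))).trans (hf.norm_left.mul hg.norm_left)
  have hdiff : (fun γ => W.rawMoment W.centered γ c - ⟪W.truncated m γ, T (W.truncated m γ)⟫_ℂ)
      =O[𝓝 0] fun γ => ‖γ‖ ^ m := by
    have h1 := hinner hR ((hO W.postselected).trans hχ)
    have h2 := hinner hX ((hO _).trans hR)
    simp only [one_mul, mul_one] at h1 h2
    refine (h1.add h2).congr_left fun γ => ?_
    rw [rawMoment, ← hT]
    simp only [map_sub, inner_sub_left, inner_sub_right]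
    ring
  have hmain : (fun γ => ⟪W.truncated m γ, T (W.truncated m γ)⟫_ℂ - ∑ x' ∈ I, ∑ x ∈ I,
      if letterCount x'.2 + letterCount x.2 = occupation c then
        (∏ j ∈ c, (γ j : ℂ)) * (starRingEnd ℂ (W.wordAmplitude x'.1 x'.2) *
          W.wordAmplitude x.1 x.2 *
          ⟪W.excited (letterCount x'.2), T (W.excited (letterCount x.2))⟫_ℂ) else 0)
      =O[𝓝 0] fun γ => ‖γ‖ ^ m := by
    have hexp (γ : Ω → ℝ) : ⟪W.truncated m γ, T (W.truncated m γ)⟫_ℂ = ∑ x' ∈ I, ∑ x ∈ I,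
        starRingEnd ℂ ((∏ j, (γ j : ℂ) ^ letterCount x'.2 j) * W.wordAmplitude x'.1 x'.2) *
          (((∏ j, (γ j : ℂ) ^ letterCount x.2 j) * W.wordAmplitude x.1 x.2) *
          ⟪W.excited (letterCount x'.2), T (W.excited (letterCount x.2))⟫_ℂ) := by
      rw [truncated, ← hI, sum_inner]
      refine Finset.sum_congr rfl fun x' _ => ?_
      rw [map_sum, inner_sum]
      refine Finset.sum_congr rfl fun x _ => ?_
      rw [map_smul, inner_smul_left, inner_smul_right]
    simp only [hexp, ← Finset.sum_sub_distrib]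
    refine IsBigO.fun_sum fun x' _ => IsBigO.fun_sum fun x _ => ?_
    have hmon (γ : Ω → ℝ) : starRingEnd ℂ (∏ j, (γ j : ℂ) ^ letterCount x'.2 j) *
        ∏ j, (γ j : ℂ) ^ letterCount x.2 j =
        ∏ j, (γ j : ℂ) ^ (letterCount x'.2 + letterCount x.2) j := by
      simp [map_prod, ← Finset.prod_mul_distrib, pow_add]
    by_cases h : letterCount x'.2 + letterCount x.2 = occupation c
    · refine (isBigO_zero _ _).congr_left fun γ => ?_
      have hc : ∏ j, (γ j : ℂ) ^ (letterCount x'.2 + letterCount x.2) j = ∏ j ∈ c, (γ j : ℂ) := by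
        rw [h]
        simp [occupation, pow_ite, Finset.prod_ite_mem]
      rw [if_pos h, ← hc, ← hmon, map_mul]
      ring
    -- The other pairs of words either have total length at most |c| and vanish, or have total
    -- length at least m and are negligible.
    · simp only [if_neg h, sub_zero]
      by_cases hcard : ∑ j, letterCount x'.2 j + ∑ j, letterCount x.2 j ≤ c.card
      · rw [hT, inner_excited_eq_zero hφ h hcard]
        simpa using isBigO_zero _ _
      · have h1 := (isBigO_monomial (letterCount x'.2 + letterCount x.2)).trans
          (isBigO_norm_pow (n := m) (by
            simp only [Pi.add_apply, Finset.sum_add_distrib]; omega))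
        refine (h1.const_mul_left (starRingEnd ℂ (W.wordAmplitude x'.1 x'.2) *
          W.wordAmplitude x.1 x.2 *
          ⟪W.excited (letterCount x'.2), T (W.excited (letterCount x.2))⟫_ℂ)).congr_left
          fun γ => ?_
        rw [← hmon, map_mul]
        ring
  have hcoef (γ : Ω → ℝ) : (∑ x' ∈ I, ∑ x ∈ I,
      if letterCount x'.2 + letterCount x.2 = occupation c then
        (∏ j ∈ c, (γ j : ℂ)) * (starRingEnd ℂ (W.wordAmplitude x'.1 x'.2) *
          W.wordAmplitude x.1 x.2 *
          ⟪W.excited (letterCount x'.2), T (W.excited (letterCount x.2))⟫_ℂ) else 0) =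
      (∏ j ∈ c, (γ j : ℂ)) *
        subsetConv W.lowestOrder (fun b => starRingEnd ℂ (W.lowestOrder b)) c := by
    -- The ket word uses the letters of b and the bra word those of c \ b. For fixed b the double
    -- sum factorizes.
    simp only [sum_occupation_split c]
    rw [Finset.sum_congr rfl fun x' _ => Finset.sum_comm, Finset.sum_comm, subsetConv,
      Finset.mul_sum]
    refine Finset.sum_congr rfl fun b hb => ?_
    rw [Finset.mem_powerset] at hb
    have hcb := Finset.card_le_card hb
    have hcb' := Finset.card_le_card (Finset.sdiff_subset (s := c) (t := b))
    have h1 := sum_wordAmplitude hτ hne b (m := m) (by omega)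
    have h2 := congrArg (starRingEnd ℂ) (sum_wordAmplitude hτ hne (c \ b) (m := m) (by omega))
    rw [← hI] at h1 h2
    have hL (b : Finset Ω) : W.lowestOrder b = (∏ j ∈ b, W.covariance j) *
        (W.overlap * ((-Complex.I) ^ b.card * W.avgWeakValue b)) := by
      rw [lowestOrder, Finset.prod_mul_distrib, Finset.prod_const]
      ring
    rw [hL b, hL (c \ b), map_mul, ← h1, ← h2, map_sum, map_prod]
    have h3 := inner_excited_occupation hr hs hφ hb
    rw [← hT] at h3
    have hre (A B X Y G : ℂ) : G * (A * X * (B * Y)) = (G * (A * B)) * (Y * X) := by ring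
    rw [hre, ← h3, Finset.sum_mul_sum, Finset.mul_sum]
    refine Finset.sum_congr rfl fun x' _ => ?_
    rw [Finset.mul_sum]
    refine Finset.sum_congr rfl fun x _ => ?_
    by_cases hx : letterCount x.2 = occupation b
    · by_cases hx' : letterCount x'.2 = occupation (c \ b)
      · simp only [hx, hx', if_true]
        ring
      · simp [hx']
    · simp [hx]
  refine (hdiff.add hmain).congr_left fun γ => ?_
  rw [hcoef γ]
  ring

end Moments

end Setup

/-! ### From the moments to the pointer cumulants. -/

namespace Setup

open Asymptotics Filter Topology

variable {Ω : Type u} {H : Ω → Type v} {S : Type w} [∀ j, NormedAddCommGroup (H j)]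
  [∀ j, InnerProductSpace ℂ (H j)] [NormedAddCommGroup S] [InnerProductSpace ℂ S]
  {W : Setup Ω H S} [DecidableEq Ω]

theorem logStar_lowestOrder (hne : W.overlap ≠ 0) {a : Finset Ω} (ha : a.Nonempty) :
    logStar W.lowestOrder a =
      (∏ j ∈ a, (-Complex.I * W.covariance j)) * logStar W.avgWeakValue a := by
  have h := logStar_const_mul
    (fun b => (∏ j ∈ b, (-Complex.I * W.covariance j)) * W.avgWeakValue b) hne ha
  rw [logStar_prod_mul _ _ ha] at h
  exact h

theorem rawMoment_r [Fintype Ω] (γ : Ω → ℝ) : W.rawMoment W.r γ =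
    subsetConv (W.rawMoment W.centered γ) fun c => ∏ j ∈ c, W.pointerMean j (W.r j) := by
  have h : W.r = fun j => W.centered j + W.pointerMean j (W.r j) • 1 := by
    ext1 j
    simp [centered]
  rw [← rawMoment_add_smul_one, ← h]

variable [CompleteSpace S]

theorem avgWeakValue_empty (hτ : 0 < W.τ) (hne : W.overlap ≠ 0) : W.avgWeakValue ∅ = 1 := by
  rw [W.avgWeakValue_eq hτ]
  -- Without interactions the amplitude is the free one, which equals the denominator.
  have h (e : Fin (Finset.card (∅ : Finset Ω)) ≃ (∅ : Finset Ω)) :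
      ⟪W.ψf, dyson W.HS (Finset.card (∅ : Finset Ω)) (fun i => W.A (e i)) W.τ W.ψi⟫_ℂ /
        ⟪W.ψf, W.sysEvol W.τ W.ψi⟫_ℂ = 1 := div_self hne
  rw [Finset.sum_congr rfl fun e _ => h e, Finset.sum_const, Finset.card_univ,
    Fintype.card_equiv (Fintype.equivOfCardEq (by rw [Fintype.card_fin, Fintype.card_coe])),
    Fintype.card_fin, Finset.card_empty]
  simp

theorem lowestOrder_empty (hτ : 0 < W.τ) (hne : W.overlap ≠ 0) : W.lowestOrder ∅ = W.overlap := by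
  simp [lowestOrder, avgWeakValue_empty hτ hne]

/-- The cumulant of the convolution is z + conj z = 2 Re z with z the cumulant of `lowestOrder`; the
2 and the weights -i cov_j make up ξ. -/
theorem logStar_lowestOrder_conv (hτ : 0 < W.τ) (hne : W.overlap ≠ 0) {a : Finset Ω}
    (ha : a.Nonempty) :
    logStar (subsetConv W.lowestOrder fun b => starRingEnd ℂ (W.lowestOrder b)) a =
      ((W.xi a * logStar W.avgWeakValue a).re : ℝ) := by
  have h0 : W.lowestOrder ∅ ≠ 0 := by rwa [lowestOrder_empty hτ hne]
  rw [logStar_subsetConv h0 (by simpa using h0) ha, logStar_conj _ ha, logStar_lowestOrder hne ha,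
    Complex.add_conj]
  congr 1
  have hxi : W.xi a * logStar W.avgWeakValue a =
      ((2 : ℝ) : ℂ) *
        ((∏ j ∈ a, (-Complex.I * W.covariance j)) * logStar W.avgWeakValue a) := by
    rw [Finset.prod_mul_distrib, Finset.prod_const]
    simp only [xi, covariance]
    push_cast
    ring
  rw [hxi, Complex.re_ofReal_mul]

variable [Fintype Ω] [∀ j, CompleteSpace (H j)]

/-- No observable enters at ∅, so the estimate for the centred ones applies to every `T`; the limit
is |overlap|². -/
theorem rawMoment_empty_ne_zero (hτ : 0 < W.τ) (hs : ∀ j, IsSelfAdjoint (W.s j))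
    (hr : ∀ j, IsSelfAdjoint (W.r j)) (hφ : ∀ j, ‖W.φ j‖ = 1) (hne : W.overlap ≠ 0)
    (T : ∀ j, H j →L[ℂ] H j) : ∀ᶠ γ in 𝓝 0, W.rawMoment T γ ∅ ≠ 0 := by
  have h := rawMoment_centered_isBigO hτ hr hs hφ hne ∅
  rw [subsetConv_empty, lowestOrder_empty hτ hne] at h
  have h1 := tendsto_of_isBigO_sub (f := fun γ => W.rawMoment W.centered γ ∅) (by simpa using h)
  filter_upwards [h1.eventually_ne (mul_ne_zero hne (by simpa using hne))] with γ hγ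
  rwa [rawMoment_empty] at hγ ⊢

theorem pointerCumulant_eventuallyEq (hτ : 0 < W.τ) (hHS : IsSelfAdjoint W.HS)
    (hA : ∀ j, IsSelfAdjoint (W.A j)) (hs : ∀ j, IsSelfAdjoint (W.s j))
    (hr : ∀ j, IsSelfAdjoint (W.r j)) (hφ : ∀ j, ‖W.φ j‖ = 1) (hne : W.overlap ≠ 0)
    {a : Finset Ω} (ha : a.Nonempty) :
    W.pointerCumulant a =ᶠ[𝓝 0] fun γ => logStar (W.rawMoment W.r γ) a := by
  filter_upwards [rawMoment_empty_ne_zero hτ hs hr hφ hne W.r] with γ hγ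
  rw [pointerCumulant, ← logStar_const_mul (W.rawMoment W.r γ) (inv_ne_zero hγ) ha]
  exact congrArg (logStar · a) (funext fun c => pointerMoment_eq hHS hA hs γ c)

theorem pointerCumulant_empty_eventuallyEq (hτ : 0 < W.τ) (hHS : IsSelfAdjoint W.HS)
    (hA : ∀ j, IsSelfAdjoint (W.A j)) (hs : ∀ j, IsSelfAdjoint (W.s j))
    (hr : ∀ j, IsSelfAdjoint (W.r j)) (hφ : ∀ j, ‖W.φ j‖ = 1) (hne : W.overlap ≠ 0) :
    W.pointerCumulant ∅ =ᶠ[𝓝 0] fun _ => 0 := by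
  filter_upwards [rawMoment_empty_ne_zero hτ hs hr hφ hne W.r] with γ hγ
  simp [pointerCumulant, logStar, pointerMoment_eq hHS hA hs, inv_mul_cancel₀ hγ]

/-- Undoing the centring adds the cumulant of ∏ ⟨r_j⟩, which is the mean on singletons and zero on
larger sets. -/
theorem pointerCumulant_isBigO (hτ : 0 < W.τ) (hHS : IsSelfAdjoint W.HS)
    (hA : ∀ j, IsSelfAdjoint (W.A j)) (hs : ∀ j, IsSelfAdjoint (W.s j))
    (hr : ∀ j, IsSelfAdjoint (W.r j)) (hφ : ∀ j, ‖W.φ j‖ = 1) (hne : W.overlap ≠ 0)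
    {a : Finset Ω} (ha : a.Nonempty) :
    (fun γ : Ω → ℝ => W.pointerCumulant a γ -
      ((if a.card = 1 then ∏ j ∈ a, W.pointerMean j (W.r j) else 0) +
        (((∏ j ∈ a, γ j) * (W.xi a * logStar W.avgWeakValue a).re : ℝ) : ℂ)))
      =O[𝓝 0] fun γ => ‖γ‖ ^ (a.card + 1) := by
  have h0 : subsetConv W.lowestOrder (fun b => starRingEnd ℂ (W.lowestOrder b)) ∅ ≠ 0 := by
    rw [subsetConv_empty, lowestOrder_empty hτ hne]
    exact mul_ne_zero hne (by simpa using hne)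
  have h := isBigO_logStar_sub h0 (rawMoment_centered_isBigO hτ hr hs hφ hne) ha
  refine h.congr' ?_ .rfl
  filter_upwards [pointerCumulant_eventuallyEq hτ hHS hA hs hr hφ hne ha,
    rawMoment_empty_ne_zero hτ hs hr hφ hne W.centered] with γ hγ hγ0
  rw [hγ, rawMoment_r, logStar_subsetConv hγ0 (by simp) ha, logStar_prod _ ha,
    logStar_lowestOrder_conv hτ hne ha]
  push_cast
  ring

end Setup

end WeakMeasurement

end

/-! ### The main theorem. -/

theorem theorem4 {Ω : Type*} [Fintype Ω] [DecidableEq Ω] {H : Ω → Type*}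
    [∀ j, NormedAddCommGroup (H j)] [∀ j, InnerProductSpace ℂ (H j)] [∀ j, CompleteSpace (H j)]
    {S : Type*} [NormedAddCommGroup S] [InnerProductSpace ℂ S] [CompleteSpace S]
    (W : WeakMeasurement.Setup Ω H S) (hτ : 0 < W.τ)
    (hHS : IsSelfAdjoint W.HS) (hA : ∀ j, IsSelfAdjoint (W.A j))
    (hs : ∀ j, IsSelfAdjoint (W.s j)) (hr : ∀ j, IsSelfAdjoint (W.r j))
    (hφ : ∀ j, ‖W.φ j‖ = 1) (hψi : ‖W.ψi‖ = 1) (hψf : ‖W.ψf‖ = 1)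
    (hne : inner ℂ W.ψf (W.sysEvol W.τ W.ψi) ≠ 0) (a : Finset Ω) :
    AnalyticAt ℝ (W.pointerCumulant a) 0 ∧
    (a.card ≠ 1 →
      (fun γ : Ω → ℝ => W.pointerCumulant a γ -
          (((∏ j ∈ a, γ j) * (W.xi a * WeakMeasurement.logStar W.avgWeakValue a).re : ℝ) : ℂ))
        =O[nhds 0] fun γ => ‖γ‖ ^ (a.card + 1)) ∧
    (∀ j, a = {j} →
      (fun γ : Ω → ℝ => W.pointerCumulant a γ - (W.pointerMean j (W.r j) +
          (((∏ j ∈ a, γ j) * (W.xi a * WeakMeasurement.logStar W.avgWeakValue a).re : ℝ) : ℂ)))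
        =O[nhds 0] fun γ => ‖γ‖ ^ (a.card + 1)) := by
  rcases a.eq_empty_or_nonempty with rfl | ha
  -- For the empty set both sides reduce to log 1 = 0 near γ = 0, as the normalized empty moment and
  -- 𝒟(∅) equal 1.
  · have h := WeakMeasurement.Setup.pointerCumulant_empty_eventuallyEq hτ hHS hA hs hr hφ hne
    refine ⟨analyticAt_const.congr h.symm, fun _ => ?_, fun j hj => ?_⟩
    · refine (Asymptotics.isBigO_zero _ _).congr' ?_ .rfl
      filter_upwards [h] with γ hγ
      simp [hγ, WeakMeasurement.logStar, WeakMeasurement.Setup.avgWeakValue_empty hτ hne]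
    · exact absurd hj.symm (Finset.singleton_ne_empty j)
  · have h := WeakMeasurement.Setup.pointerCumulant_isBigO hτ hHS hA hs hr hφ hne ha
    refine ⟨?_, fun hcard => ?_, ?_⟩
    · have h0 := WeakMeasurement.Setup.rawMoment_empty_ne_zero hτ hs hr hφ hne W.r
      exact (WeakMeasurement.analyticAt_logStar (fun c => W.analyticAt_rawMoment W.r c 0)
        h0.self_of_nhds ha).congr
        (WeakMeasurement.Setup.pointerCumulant_eventuallyEq hτ hHS hA hs hr hφ hne ha).symm
    · simpa [hcard] using h
    · rintro j rfl
      simpa using h
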